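/- **Theorem.** Let $w:\mathbb{R}^2\to\mathbb{R}^2$ be given by $w(x)=(0,4x_1)$ if $|x_2|<|x_1|<1/2$, $w(x)=(-4x_2,0)$ if $|x_1|<|x_2|<1/2$, and $w(x)=0$ otherwise. Let $u(x)=\sum_{y} w(x-y)$, the sum being over all $y=(y_1,y_2)\in\mathbb{Z}^2$ with $y_1+y_2$ even. Depauw's vector field $b_{DP}:[0,\infty)\times\mathbb{R}^2\to\mathbb{R}^2$ is defined by $b_{DP}(t,x)=u(2^kx)$ for $2^{-(k+1)}<t<2^{-k}$, $k=0,1,2,\dots$, and $b_{DP}(t,x)=0$ for $t>1$ (and for the remaining times, which form a null set). It is bounded, it is divergence-free in $x$ in the sense of distributions, and it belongs to $L^1_{loc}((0,\infty);BV_{loc}(\mathbb{R}^2;\mathbb{R}^2))$. Consider the Cauchy problem $$\partial_t\rho+\operatorname{div}_x(b_{DP}\,\rho)=0,\qquad \rho(0,\cdot)=\bar\rho .\tag{IVP}$$ A bounded weak solution of (IVP) is a function $\rho\in L^\infty_{loc}([0,\infty);L^\infty(\mathbb{R}^2))$ such that $$\int_0^\infty\!\!\int_{\mathbb{R}^2}\rho\,\big(\partial_t\phi+b_{DP}\cdot\nabla_x\phi\big)\,dx\,dt=-\int_{\mathbb{R}^2}\bar\rho(x)\,\phi(0,x)\,dx\qquad\text{for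 every }\phi\in C_c^\infty([0,\infty)\times\mathbb{R}^2).$$ Let $\bar\rho\in L^\infty(\mathbb{R}^2)$. Then (IVP) has at least two distinct bounded weak solutions, where distinct means that they do not coincide almost everywhere on $[0,\infty)\times\mathbb{R}^2$. Moreover, if $\bar\rho\ge 0$ almost everywhere and $\bar\rho$ is not almost everywhere zero, then (IVP) has at least two distinct bounded weak solutions that are non-negative almost everywhere. -/

import Mathlib

open MeasureTheory Set
open scoped ContDiff ENNReal NNReal

noncomputable section

/-- The measure `dt dx` on `[0, ∞) × ℝ^d`. -/
def spaceTimeMeasure (d : ℕ) : Measure (ℝ × EuclideanSpace ℝ (Fin d)) :=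
  volume.restrict (Ici (0 : ℝ) ×ˢ (univ : Set (EuclideanSpace ℝ (Fin d))))

/-- Weak solutions `ρ ∈ L^∞_loc([0, ∞); L^1_loc(ℝ^d))` of the Cauchy problem
`∂ₜ ρ + div (b ρ) = 0`, `ρ(0, ·) = ρ₀`. The test functions in `C_c^∞([0, ∞) × ℝ^d)` are the
restrictions to `t ≥ 0` of the functions in `C_c^∞(ℝ × ℝ^d)`, and the derivative of `φ` at `(t, x)`
in the direction `(1, b(t, x))` is `∂ₜ φ + b · ∇ₓ φ`. Values at negative times play no role. -/
structure IsWeakSolution {d : ℕ}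
    (b : ℝ × EuclideanSpace ℝ (Fin d) → EuclideanSpace ℝ (Fin d))
    (ρ₀ : EuclideanSpace ℝ (Fin d) → ℝ)
    (ρ : ℝ × EuclideanSpace ℝ (Fin d) → ℝ) : Prop where
  aestronglyMeasurable : AEStronglyMeasurable ρ (spaceTimeMeasure d)
  locally_bounded_in_L1 : ∀ T R : ℝ, ∃ C : ℝ≥0, ∀ᵐ t ∂(volume.restrict (Icc (0 : ℝ) T)),
    ∫⁻ x in Metric.ball (0 : EuclideanSpace ℝ (Fin d)) R, ‖ρ (t, x)‖ₑ ≤ C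
  weak_formulation : ∀ φ : ℝ × EuclideanSpace ℝ (Fin d) → ℝ,
    ContDiff ℝ ∞ φ → HasCompactSupport φ →
      ∫ t in Ioi (0 : ℝ), ∫ x, ρ (t, x) * fderiv ℝ φ (t, x) (1, b (t, x)) =
        - ∫ x, ρ₀ x * φ (0, x)

/-- Bounded weak solutions: weak solutions that lie in `L^∞_loc([0, ∞); L^∞(ℝ^d))`. -/
structure IsBoundedWeakSolution {d : ℕ}
    (b : ℝ × EuclideanSpace ℝ (Fin d) → EuclideanSpace ℝ (Fin d))
    (ρ₀ : EuclideanSpace ℝ (Fin d) → ℝ)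
    (ρ : ℝ × EuclideanSpace ℝ (Fin d) → ℝ) : Prop extends IsWeakSolution b ρ₀ ρ where
  locally_bounded : ∀ T : ℝ, ∃ C : ℝ, ∀ᵐ p ∂(spaceTimeMeasure d), p.1 ≤ T → |ρ p| ≤ C

/-- `b` is a (Borel) bounded vector field. -/
def IsBoundedField {d : ℕ}
    (b : ℝ × EuclideanSpace ℝ (Fin d) → EuclideanSpace ℝ (Fin d)) : Prop :=
  Measurable b ∧ ∃ C : ℝ, ∀ p, ‖b p‖ ≤ C

/-- `divₓ b(t, ·) = 0` in the sense of distributions on `ℝ^d`, for almost every `t > 0`. -/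
def IsDivergenceFree {d : ℕ}
    (b : ℝ × EuclideanSpace ℝ (Fin d) → EuclideanSpace ℝ (Fin d)) : Prop :=
  ∀ᵐ t ∂(volume.restrict (Ioi (0 : ℝ))), ∀ ψ : EuclideanSpace ℝ (Fin d) → ℝ,
    ContDiff ℝ ∞ ψ → HasCompactSupport ψ → ∫ x, fderiv ℝ ψ x (b (t, x)) = 0

/-- The divergence of a differentiable vector field on `ℝ^d`. -/
def divergence {d : ℕ} (Φ : EuclideanSpace ℝ (Fin d) → EuclideanSpace ℝ (Fin d))
    (x : EuclideanSpace ℝ (Fin d)) : ℝ :=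
  ∑ j : Fin d, fderiv ℝ Φ x (EuclideanSpace.single j (1 : ℝ)) j

/-- The total variation `|Df|(Ω)` of a locally integrable vector field `f` on an open set `Ω`: the
supremum of `∫ ∑ᵢ fᵢ div Φᵢ` over the matrix fields `Φ ∈ C_c^∞(Ω; ℝ^{d×d})`, with rows `Φᵢ`, whose
Frobenius norm is at most one at every point. -/
def totalVariation {d : ℕ} (f : EuclideanSpace ℝ (Fin d) → EuclideanSpace ℝ (Fin d))
    (Ω : Set (EuclideanSpace ℝ (Fin d))) : ℝ≥0∞ :=
  ⨆ (Φ : Fin d → EuclideanSpace ℝ (Fin d) → EuclideanSpace ℝ (Fin d))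
    (_ : ∀ i, ContDiff ℝ ∞ (Φ i) ∧ HasCompactSupport (Φ i) ∧ tsupport (Φ i) ⊆ Ω)
    (_ : ∀ x, ∑ i, ‖Φ i x‖ ^ 2 ≤ 1),
    ENNReal.ofReal (∫ x, ∑ i, f x i * divergence (Φ i) x)

/-- `b ∈ L^1_loc((0, ∞); BV_loc(ℝ^d; ℝ^d))`: on every compact time interval in `(0, ∞)` and every
ball, the norm `‖b(t, ·)‖_{L^1} + |D b(t, ·)|` on the ball is integrable in time. -/
def IsL1locBVloc {d : ℕ}
    (b : ℝ × EuclideanSpace ℝ (Fin d) → EuclideanSpace ℝ (Fin d)) : Prop :=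
  AEStronglyMeasurable b (spaceTimeMeasure d) ∧
  ∀ s T R : ℝ, 0 < s →
    ∫⁻ t in Icc s T,
      ((∫⁻ x in Metric.ball (0 : EuclideanSpace ℝ (Fin d)) R, ‖b (t, x)‖ₑ) +
        totalVariation (fun x => b (t, x)) (Metric.ball 0 R)) < ⊤

/-- The autonomous field `w`, rotating about the origin inside the square of side one. -/
def depauwW (x : EuclideanSpace ℝ (Fin 2)) : EuclideanSpace ℝ (Fin 2) :=
  if |x 1| < |x 0| ∧ |x 0| < 1 / 2 then !₂[0, 4 * x 0]
  else if |x 0| < |x 1| ∧ |x 1| < 1 / 2 then !₂[-4 * x 1, 0]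
  else 0

/-- The periodised field `u(x) = ∑ w(x - y)`, over the `y ∈ ℤ²` with `y₁ + y₂` even. At most one
term of the sum is nonzero. -/
def depauwU (x : EuclideanSpace ℝ (Fin 2)) : EuclideanSpace ℝ (Fin 2) :=
  ∑' y : {y : ℤ × ℤ // Even (y.1 + y.2)}, depauwW (x - !₂[(y.1.1 : ℝ), (y.1.2 : ℝ)])

/-- Depauw's field: `b(t, x) = u(2^k x)` for `2^{-(k+1)} < t < 2^{-k}`, `k = 0, 1, 2, …`, and
`b(t, x) = 0` for `t > 1` (and on the null set of the remaining times). The intervals are disjoint,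
so at most one term of the sum is nonzero. -/
def depauwField (p : ℝ × EuclideanSpace ℝ (Fin 2)) : EuclideanSpace ℝ (Fin 2) :=
  ∑' k : ℕ, (Ioo ((1 / 2 : ℝ) ^ (k + 1)) ((1 / 2 : ℝ) ^ k)).indicator
    (fun _ => depauwU ((2 : ℝ) ^ k • p.2)) p.1

end

/-! On the time interval `(2⁻⁽ᵏ⁺¹⁾, 2⁻ᵏ)` the field rotates every second cell of side `2⁻ᵏ` along
concentric squares. The rotation generated by `w` has period `2`, and the rescaled interval has
length `1/2`, so over one level each active cell makes exactly a quarter turn. The flow is explicit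
and piecewise a shear, hence preserves area (`measurePreserving_cellFlow`), and a bounded density
constant along its trajectories solves the equation away from time zero (`integral_transport`). A
solution can therefore be prescribed by its value `G` at time one; it only remains to identify its
weak limit at time zero (`isBoundedWeakSolution_toTimeOne`).

Level `k` moves points by at most `2 · 2⁻ᵏ`, so trajectories followed backwards converge, and the
limit `S = cascadeLimit` preserves measure. The choice `G = F ∘ S` has initial datum `F`: at time
`2⁻ᵏ` it is `F` composed with a measure preserving map within `4 · 2⁻ᵏ` of the identity
(`norm_cascadeLimit_cascade_sub_le`, `tendsto_integral_comp_mul_sub`).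

The unit checkerboard at time one behaves differently. Going back through one level halves its side,
up to a sign (`cellSign_cellFlow_half`), so at time `2⁻ᵏ` it has side `2⁻ᵏ`, and it tends weakly to
zero (`tendsto_integral_mul_cellSign`). Multiplying it by `H ∘ S` does not change this, because that
factor converges in `L¹` on bounded sets. Hence `G = F ∘ S + (H ∘ S) · cellSign` has initial datum
`F` for every bounded `H`, while `|cellSign| = 1` and the invariance of measure under `S` make `H`
visible after time one. The pairs `H = 0, 1` and, for `F ≥ 0`, `H = 0, F` give the theorem, since `F
· (1 + cellSign) ≥ 0`.

As for the field, its divergence vanishes because its flow preserves integrals. On a ball and away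
from time zero only finitely many cells and levels occur, and the variation on one cell is bounded
by integrating along coordinate lines. -/

/-! ### Rotation along squares: the flow of `w` -/

/-- The Euclidean plane. -/
abbrev Plane : Type := EuclideanSpace ℝ (Fin 2)

/-- The rotation of the plane by a right angle. -/
noncomputable def quarterTurn : Plane ≃ₗᵢ[ℝ] Plane where
  toFun x := !₂[-x 1, x 0]
  invFun x := !₂[x 1, -x 0]
  map_add' x y := by ext i; fin_cases i <;> simp; ring
  map_smul' c x := by ext i; fin_cases i <;> simp
  left_inv x := by ext i; fin_cases i <;> simp
  right_inv x := by ext i; fin_cases i <;> simp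
  norm_map' x := by
    simp [EuclideanSpace.norm_eq, Fin.sum_univ_two, add_comm]

theorem quarterTurn_apply (x : Plane) : quarterTurn x = !₂[-x 1, x 0] := rfl

theorem linearIsometryEquiv_mul_apply (e f : Plane ≃ₗᵢ[ℝ] Plane) (x : Plane) : (e * f) x = e (f x) := rfl

theorem quarterTurn_zpow_two : quarterTurn ^ (2 : ℤ) = LinearIsometryEquiv.neg ℝ := by
  ext x i
  rw [zpow_two]
  fin_cases i <;> simp [quarterTurn_apply]

theorem quarterTurn_zpow_four : quarterTurn ^ (4 : ℤ) = 1 := by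
  ext x i
  rw [show (4 : ℤ) = 2 + 2 by norm_num, zpow_add, quarterTurn_zpow_two]
  fin_cases i <;> simp

theorem quarterTurn_zpow_add_one (j : ℤ) (x : Plane) :
    (quarterTurn ^ (j + 1)) x = (quarterTurn ^ j) (quarterTurn x) := by
  rw [zpow_add_one]; rfl

/-- The curve of speed one and period `8` along the boundary of the square `max |x₁| |x₂| = 1`. -/
noncomputable def squareCurve (θ : ℝ) : Plane :=
  (quarterTurn ^ round (θ / 2)) !₂[1, θ - 2 * round (θ / 2)]

theorem abs_sub_two_mul_round_le (θ : ℝ) : |θ - 2 * round (θ / 2)| ≤ 1 := by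
  have h := abs_sub_round (θ / 2)
  rw [abs_le] at *
  constructor <;> linarith [h.1, h.2]

/-- At a corner two neighbouring sides are admissible and both formulas give that corner, so the
rounding convention in the definition is immaterial. -/
theorem squareCurve_eq {θ : ℝ} {j : ℤ} (h : |θ - 2 * j| ≤ 1) :
    squareCurve θ = (quarterTurn ^ j) !₂[1, θ - 2 * j] := by
  have h' := abs_sub_two_mul_round_le θ
  unfold squareCurve
  generalize round (θ / 2) = i at *
  rw [abs_le] at h h'
  have h1 : i ≤ j + 1 := by
    have : (i : ℝ) ≤ j + 1 := by linarith [h.1, h'.1, h.2, h'.2]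
    exact_mod_cast this
  have h2 : j ≤ i + 1 := by
    have : (j : ℝ) ≤ i + 1 := by linarith [h.1, h'.1, h.2, h'.2]
    exact_mod_cast this
  have h3 : i = j ∨ i = j + 1 ∨ j = i + 1 := by omega
  rcases h3 with rfl | rfl | rfl
  · rfl
  · push_cast at *
    have : θ = 2 * j + 1 := by linarith [h'.1, h.2]
    subst this
    rw [quarterTurn_zpow_add_one, quarterTurn_apply]
    congr 2
    ext k; fin_cases k <;> simp <;> ring
  · push_cast at *
    have : θ = 2 * i + 1 := by linarith [h'.2, h.1]
    subst this
    rw [quarterTurn_zpow_add_one, quarterTurn_apply]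
    congr 2
    ext k; fin_cases k <;> simp <;> ring

theorem squareCurve_add_two (θ : ℝ) : squareCurve (θ + 2) = quarterTurn (squareCurve θ) := by
  have h := abs_sub_two_mul_round_le θ
  have e : θ + 2 - 2 * ((1 + round (θ / 2) : ℤ) : ℝ) = θ - 2 * round (θ / 2) := by push_cast; ring
  rw [squareCurve_eq (j := 1 + round (θ / 2)) (by rwa [e]), e, zpow_add, zpow_one]
  rfl

theorem squareCurve_add_eight_mul (θ : ℝ) (n : ℤ) : squareCurve (θ + 8 * n) = squareCurve θ := by
  have h := abs_sub_two_mul_round_le θ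
  have e : θ + 8 * n - 2 * ((4 * n + round (θ / 2) : ℤ) : ℝ) = θ - 2 * round (θ / 2) := by
    push_cast; ring
  rw [squareCurve_eq (j := 4 * n + round (θ / 2)) (by rwa [e]), e, zpow_add, zpow_mul,
    quarterTurn_zpow_four, one_zpow, one_mul]
  rfl

/-- Since the fourth power of the quarter turn is the identity, only the relative position `r = 0,
1, 2, 3` of the two sides matters. For `r = 0` the offsets agree, for `r = 1, 3` the sides meet in a
single corner, and opposite sides are disjoint. -/
theorem squareCurve_injective_mod_eight {s t : ℝ} (h : squareCurve s = squareCurve t) :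
    ∃ n : ℤ, t = s + 8 * n := by
  have hs := abs_sub_two_mul_round_le s
  have ht := abs_sub_two_mul_round_le t
  unfold squareCurve at h
  generalize round (s / 2) = i at *
  generalize round (t / 2) = j at *
  obtain ⟨a, rfl⟩ : ∃ a, s = a + 2 * i := ⟨s - 2 * i, by ring⟩
  obtain ⟨b, rfl⟩ : ∃ b, t = b + 2 * j := ⟨t - 2 * j, by ring⟩
  simp only [add_sub_cancel_right] at *
  obtain ⟨m, rfl⟩ : ∃ m, j = i + m := ⟨j - i, by ring⟩
  rw [zpow_add] at h
  replace h : !₂[1, a] = (quarterTurn ^ m) !₂[1, b] := (quarterTurn ^ i).injective h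
  obtain ⟨q, r, hr0, hr4, rfl⟩ : ∃ q r : ℤ, 0 ≤ r ∧ r < 4 ∧ m = 4 * q + r :=
    ⟨m / 4, m % 4, by omega, by omega, by omega⟩
  rw [zpow_add, zpow_mul, quarterTurn_zpow_four, one_zpow, one_mul] at h
  rw [abs_le] at hs ht
  have h0 := congrArg (fun x : Plane => x 0) h
  have h1 := congrArg (fun x : Plane => x 1) h
  interval_cases r
  · simp at h1
    exact ⟨q, by push_cast; rw [h1]; ring⟩
  · simp [quarterTurn_apply] at h0 h1
    exact ⟨q, by push_cast; linarith⟩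
  · rw [quarterTurn_zpow_two] at h0
    simp at h0
    norm_num at h0
  · rw [show (3 : ℤ) = 1 + 2 by norm_num, zpow_add, quarterTurn_zpow_two] at h0 h1
    simp [quarterTurn_apply] at h0 h1
    exact ⟨q + 1, by push_cast; linarith⟩

theorem hasDerivAt_squareCurve {θ : ℝ} {j : ℤ} (h : |θ - 2 * j| < 1) :
    HasDerivAt squareCurve ((quarterTurn ^ j) !₂[0, 1]) θ := by
  have h1 : HasDerivAt (fun t : ℝ => (quarterTurn ^ j) (!₂[1, t - 2 * j] : Plane))
      ((quarterTurn ^ j) !₂[0, 1]) θ := by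
    have h2 : HasDerivAt (fun t : ℝ => (!₂[1, t - 2 * j] : Plane)) !₂[0, 1] θ := by
      have h3 : HasDerivAt (fun t : ℝ => ![1, t - 2 * j]) ![0, 1] θ := by
        rw [hasDerivAt_pi]
        intro i
        fin_cases i
        · simpa using hasDerivAt_const θ (1 : ℝ)
        · simpa using (hasDerivAt_id θ).sub_const (2 * (j : ℝ))
      exact ((PiLp.continuousLinearEquiv 2 ℝ (fun _ : Fin 2 => ℝ)).symm
        |>.toContinuousLinearMap.hasFDerivAt).comp_hasDerivAt θ h3
    exact ((quarterTurn ^ j).toContinuousLinearEquiv.toContinuousLinearMap.hasFDerivAt).comp_hasDerivAt θ h2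
  refine h1.congr_of_eventuallyEq ?_
  have : ∀ᶠ t : ℝ in nhds θ, |t - 2 * j| < 1 :=
    (Continuous.continuousAt (by fun_prop)).eventually_lt continuousAt_const h
  filter_upwards [this] with t ht using squareCurve_eq ht.le

theorem continuous_squareCurve : Continuous squareCurve := by
  have key : ∀ j : ℤ, ContinuousOn squareCurve (Icc (2 * j - 1 : ℝ) (2 * j + 1)) := by
    intro j
    have h1 : Continuous (fun t : ℝ => (quarterTurn ^ j) (!₂[1, t - 2 * j] : Plane)) := by
      refine (quarterTurn ^ j).continuous.comp ?_
      refine (PiLp.continuous_toLp 2 _).comp (continuous_pi fun i => ?_)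
      fin_cases i <;> simp <;> fun_prop
    refine h1.continuousOn.congr fun t ht => squareCurve_eq ?_
    rw [abs_le]; constructor <;> linarith [ht.1, ht.2]
  rw [continuous_iff_continuousAt]
  intro θ
  rw [continuousAt_iff_continuous_left_right]
  constructor
  -- The ceiling selects the side `j` with `2j - 1 < θ ≤ 2j + 1`, which covers a left neighbourhood
  -- of `θ`; the floor below does the same on the right.
  · have h1 := Int.ceil_lt_add_one ((θ - 1) / 2)
    have h2 := Int.le_ceil ((θ - 1) / 2)
    refine ((key ⌈(θ - 1) / 2⌉) θ ⟨by linarith, by linarith⟩).mono_of_mem_nhdsWithin ?_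
    filter_upwards [self_mem_nhdsWithin,
      mem_nhdsWithin_of_mem_nhds (Ioi_mem_nhds (show 2 * (⌈(θ - 1) / 2⌉ : ℝ) - 1 < θ by linarith))]
      with t ht1 ht2
    simp at ht1 ht2
    exact ⟨by linarith, by linarith⟩
  · have h1 := Int.lt_floor_add_one ((θ + 1) / 2)
    have h2 := Int.floor_le ((θ + 1) / 2)
    refine ((key ⌊(θ + 1) / 2⌋) θ ⟨by linarith, by linarith⟩).mono_of_mem_nhdsWithin ?_
    filter_upwards [self_mem_nhdsWithin,
      mem_nhdsWithin_of_mem_nhds (Iio_mem_nhds (show θ < 2 * (⌊(θ + 1) / 2⌋ : ℝ) + 1 by linarith))]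
      with t ht1 ht2
    simp at ht1 ht2
    exact ⟨by linarith, by linarith⟩

/-- The maximum norm of the plane. -/
noncomputable def supNorm (x : Plane) : ℝ := max |x 0| |x 1|

theorem supNorm_nonneg (x : Plane) : 0 ≤ supNorm x := le_max_of_le_left (abs_nonneg _)

theorem supNorm_quarterTurn (x : Plane) : supNorm (quarterTurn x) = supNorm x := by
  simp [supNorm, quarterTurn_apply, max_comm]

theorem supNorm_quarterTurn_zpow (j : ℤ) (x : Plane) :
    supNorm ((quarterTurn ^ j) x) = supNorm x := by
  induction j with
  | zero => simp
  | succ n ih => rw [add_comm, zpow_add, zpow_one]; simpa [supNorm_quarterTurn] using ih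
  | pred n ih =>
    rw [← ih, ← supNorm_quarterTurn, ← linearIsometryEquiv_mul_apply, ← zpow_one_add]
    congr 3; ring

theorem supNorm_smul (r : ℝ) (x : Plane) : supNorm (r • x) = |r| * supNorm x := by
  simp [supNorm, abs_mul, mul_max_of_nonneg]

theorem supNorm_squareCurve (θ : ℝ) : supNorm (squareCurve θ) = 1 := by
  have := abs_sub_two_mul_round_le θ
  rw [squareCurve, supNorm_quarterTurn_zpow]
  simp [supNorm, this]

theorem norm_le_two_mul_supNorm (x : Plane) : ‖x‖ ≤ 2 * supNorm x := by
  have h := supNorm_nonneg x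
  rw [EuclideanSpace.norm_eq, Real.sqrt_le_left (by linarith), Fin.sum_univ_two]
  simp only [Real.norm_eq_abs]
  have h0 : |x 0| ≤ supNorm x := le_max_left _ _
  have h1 : |x 1| ≤ supNorm x := le_max_right _ _
  nlinarith [abs_nonneg (x 0), abs_nonneg (x 1)]

/-- The parameter, determined modulo `8`, of the direction of a point along `squareCurve`. -/
noncomputable def squareAngle (x : Plane) : ℝ :=
  if |x 1| ≤ |x 0| then (if 0 ≤ x 0 then x 1 / x 0 else 4 + x 1 / x 0)
  else (if 0 ≤ x 1 then 2 - x 0 / x 1 else 6 - x 0 / x 1)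

/-- `supNorm` and `squareAngle` are polar coordinates adapted to squares; the four branches of the
angle are the sides `0, 2, 1, 3`. At the origin the radius vanishes, so the value of the angle is
irrelevant. -/
theorem supNorm_smul_squareCurve_squareAngle (x : Plane) :
    supNorm x • squareCurve (squareAngle x) = x := by
  rcases le_or_gt |x 1| |x 0| with h | h
  · have hs : supNorm x = |x 0| := max_eq_left h
    have hd : |x 1 / x 0| ≤ 1 := by rw [abs_div]; exact div_le_one_of_le₀ h (abs_nonneg _)
    by_cases hz : x 0 = 0
    · have hz1 : x 1 = 0 := by simpa [hz] using h
      rw [hs, hz]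
      ext i; fin_cases i <;> simp [hz, hz1]
    rcases le_or_gt 0 (x 0) with h0 | h0
    · rw [squareAngle, if_pos h, if_pos h0, squareCurve_eq (j := 0) (by simpa using hd), hs,
        abs_of_nonneg h0]
      ext i; fin_cases i <;> simp
      field_simp
    · rw [squareAngle, if_pos h, if_neg h0.not_ge, squareCurve_eq (j := 2)
        (by push_cast; ring_nf; rwa [← div_eq_mul_inv]), hs, abs_of_neg h0, quarterTurn_zpow_two]
      ext i; fin_cases i <;> simp
      field_simp; ring
  · have hs : supNorm x = |x 1| := max_eq_right h.le
    have hd : |x 0 / x 1| ≤ 1 := by rw [abs_div]; exact div_le_one_of_le₀ h.le (abs_nonneg _)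
    have hz : x 1 ≠ 0 := by
      intro hz
      rw [hz, abs_zero] at h
      exact absurd h (abs_nonneg _).not_gt
    rcases le_or_gt 0 (x 1) with h0 | h0
    · rw [squareAngle, if_neg h.not_ge, if_pos h0, squareCurve_eq (j := 1)
        (by push_cast; ring_nf; rwa [← div_eq_mul_inv, abs_neg]), hs, abs_of_nonneg h0, zpow_one,
        quarterTurn_apply]
      ext i; fin_cases i <;> simp
      field_simp
    · rw [squareAngle, if_neg h.not_ge, if_neg h0.not_ge, squareCurve_eq (j := 3)
        (by push_cast; ring_nf; rwa [← div_eq_mul_inv, abs_neg]), hs, abs_of_neg h0,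
        show (3 : ℤ) = 1 + 2 by norm_num, zpow_add, quarterTurn_zpow_two, zpow_one]
      ext i; fin_cases i <;> simp [quarterTurn_apply]
      field_simp; ring

theorem measurable_squareAngle : Measurable squareAngle := by
  unfold squareAngle
  have h0 : Measurable fun x : Plane => x 0 := by fun_prop
  have h1 : Measurable fun x : Plane => x 1 := by fun_prop
  refine Measurable.ite (measurableSet_le h1.abs h0.abs)
    (Measurable.ite (measurableSet_le measurable_const h0) ?_ ?_)
    (Measurable.ite (measurableSet_le measurable_const h1) ?_ ?_) <;> fun_prop

/-- The flow of the field that rotates about the origin along squares, with period `2`. -/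
noncomputable def squareFlow (τ : ℝ) (x : Plane) : Plane :=
  supNorm x • squareCurve (squareAngle x + 4 * τ)

/-- The flow may be computed from any angle of the point, not only from `squareAngle`, because two
angles differ by a multiple of the period `8`. The group law follows. -/
theorem squareFlow_smul_squareCurve {r : ℝ} (hr : 0 ≤ r) (τ s : ℝ) :
    squareFlow τ (r • squareCurve s) = r • squareCurve (s + 4 * τ) := by
  have h1 : supNorm (r • squareCurve s) = r := by
    rw [supNorm_smul, supNorm_squareCurve, abs_of_nonneg hr, mul_one]
  rcases hr.eq_or_lt with rfl | hr
  · rw [squareFlow, h1, zero_smul, zero_smul]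
  have h2 := supNorm_smul_squareCurve_squareAngle (r • squareCurve s)
  rw [h1] at h2
  obtain ⟨n, hn⟩ := squareCurve_injective_mod_eight (smul_right_injective _ hr.ne' h2)
  rw [squareFlow, h1, ← squareCurve_add_eight_mul _ n, add_right_comm, ← hn]

theorem supNorm_squareFlow (τ : ℝ) (x : Plane) : supNorm (squareFlow τ x) = supNorm x := by
  rw [squareFlow, supNorm_smul, supNorm_squareCurve, mul_one, abs_of_nonneg (supNorm_nonneg x)]

theorem squareFlow_squareFlow (σ τ : ℝ) (x : Plane) :
    squareFlow σ (squareFlow τ x) = squareFlow (τ + σ) x := by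
  rw [squareFlow.eq_1 τ, squareFlow_smul_squareCurve (supNorm_nonneg x), squareFlow]
  congr 2; ring

theorem squareFlow_zero (x : Plane) : squareFlow 0 x = x := by
  rw [squareFlow, mul_zero, add_zero, supNorm_smul_squareCurve_squareAngle]

theorem squareFlow_half (x : Plane) : squareFlow (1 / 2) x = quarterTurn x := by
  rw [squareFlow, show 4 * (1 / 2 : ℝ) = 2 by norm_num, squareCurve_add_two, ← map_smul,
    supNorm_smul_squareCurve_squareAngle]

theorem depauwW_quarterTurn (x : Plane) : depauwW (quarterTurn x) = quarterTurn (depauwW x) := by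
  have e0 : quarterTurn x 0 = - x 1 := by simp [quarterTurn_apply]
  have e1 : quarterTurn x 1 = x 0 := by simp [quarterTurn_apply]
  unfold depauwW
  rw [e0, e1, abs_neg]
  split_ifs with h1 h2 h3
  · exact absurd (h1.1.trans h2.1) (lt_irrefl _)
  · ext i; fin_cases i <;> simp [quarterTurn_apply]
  · ext i; fin_cases i <;> simp [quarterTurn_apply]
  · simp

theorem depauwW_quarterTurn_zpow (j : ℤ) (x : Plane) :
    depauwW ((quarterTurn ^ j) x) = (quarterTurn ^ j) (depauwW x) := by
  induction j with
  | zero => simp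
  | succ n ih => rw [add_comm, zpow_add, zpow_one]; simpa [depauwW_quarterTurn] using ih
  | pred n ih =>
    apply quarterTurn.injective
    rw [← depauwW_quarterTurn, ← linearIsometryEquiv_mul_apply, ← linearIsometryEquiv_mul_apply,
      ← zpow_one_add, show (1 + (-(n : ℤ) - 1)) = -n by ring, ih]

/-- The strict inequality excludes the corners. As `depauwW` commutes with the quarter turn, it
suffices to treat the right-hand side of the square, where a point has first coordinate `r` and both
velocities are `(0, 4r)`. -/
theorem hasDerivAt_squareFlow {x : Plane} (hx : supNorm x < 1 / 2) {τ : ℝ} {j : ℤ}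
    (h : |squareAngle x + 4 * τ - 2 * j| < 1) :
    HasDerivAt (fun τ => squareFlow τ x) (depauwW (squareFlow τ x)) τ := by
  have h1 : HasDerivAt (fun τ => squareFlow τ x)
      (supNorm x • ((4 : ℝ) • (quarterTurn ^ j) !₂[0, 1])) τ := by
    have h2 : HasDerivAt (fun τ : ℝ => squareAngle x + 4 * τ) 4 τ := by
      simpa using ((hasDerivAt_id τ).const_mul 4).const_add (squareAngle x)
    exact ((hasDerivAt_squareCurve h).scomp τ h2).const_smul (supNorm x)
  convert h1 using 1
  rw [squareFlow, squareCurve_eq h.le, ← map_smul, ← map_smul, ← map_smul, depauwW_quarterTurn_zpow]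
  congr 1
  set r := supNorm x with hr
  have hr0 : 0 ≤ r := supNorm_nonneg x
  generalize squareAngle x + 4 * τ - 2 * j = a at *
  rcases hr0.eq_or_lt with h0 | h0
  · rw [← h0]
    simp [depauwW]
  · rw [depauwW, if_pos]
    · ext i; fin_cases i <;> simp; ring
    · simp [abs_mul, abs_of_pos h0]
      exact ⟨by nlinarith, by linarith⟩

/-! ### The cells and the periodised field -/

/-- A pair of integers as a point of the plane. -/
noncomputable def latticePoint (n : ℤ × ℤ) : Plane := !₂[(n.1 : ℝ), (n.2 : ℝ)]

/-- The centre of the unit cell that contains `x`. -/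
noncomputable def nearestCell (x : Plane) : ℤ × ℤ := (round (x 0), round (x 1))

/-- The point `x` lies in the interior of a cell in which Depauw's field rotates. -/
def IsActive (x : Plane) : Prop :=
  Even ((nearestCell x).1 + (nearestCell x).2) ∧ supNorm (x - latticePoint (nearestCell x)) < 1 / 2

theorem nearestCell_latticePoint_add {z : Plane} (hz : supNorm z < 1 / 2) (n : ℤ × ℤ) :
    nearestCell (latticePoint n + z) = n := by
  have h0 : |z 0| < 1 / 2 := (le_max_left _ _).trans_lt hz
  have h1 : |z 1| < 1 / 2 := (le_max_right _ _).trans_lt hz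
  rw [abs_lt] at h0 h1
  have r0 : round (z 0) = 0 := round_eq_zero_iff.2 ⟨h0.1.le, h0.2⟩
  have r1 : round (z 1) = 0 := round_eq_zero_iff.2 ⟨h1.1.le, h1.2⟩
  simp [nearestCell, latticePoint, r0, r1]

theorem isActive_latticePoint_add_iff {z : Plane} (hz : supNorm z < 1 / 2) (n : ℤ × ℤ) :
    IsActive (latticePoint n + z) ↔ Even (n.1 + n.2) := by
  simp only [IsActive, nearestCell_latticePoint_add hz, add_sub_cancel_left, hz, and_true]

theorem IsActive.exists_eq {x : Plane} (hx : IsActive x) :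
    ∃ (n : ℤ × ℤ) (z : Plane), Even (n.1 + n.2) ∧ supNorm z < 1 / 2 ∧ x = latticePoint n + z :=
  ⟨nearestCell x, x - latticePoint (nearestCell x), hx.1, hx.2, by abel⟩

theorem supNorm_lt_half_of_depauwW_ne_zero {x : Plane} (hx : depauwW x ≠ 0) :
    supNorm x < 1 / 2 := by
  unfold depauwW at hx
  split_ifs at hx with h1 h2
  · exact max_lt h1.2 (h1.1.trans h1.2)
  · exact max_lt (h2.1.trans h2.2) h2.2
  · exact absurd rfl hx

/-- The open cells are disjoint, so a nonzero term of the periodising sum determines its index. -/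
theorem isActive_and_nearestCell_eq {x : Plane} {n : ℤ × ℤ} (hn : Even (n.1 + n.2))
    (hx : depauwW (x - latticePoint n) ≠ 0) : IsActive x ∧ nearestCell x = n := by
  have h := supNorm_lt_half_of_depauwW_ne_zero hx
  have h1 := nearestCell_latticePoint_add h n
  have h2 := (isActive_latticePoint_add_iff h n).2 hn
  rw [add_sub_cancel] at h1 h2
  exact ⟨h2, h1⟩

open Classical in
theorem depauwU_eq_ite (x : Plane) :
    depauwU x = if IsActive x then depauwW (x - latticePoint (nearestCell x)) else 0 := by
  change ∑' y : {y : ℤ × ℤ // Even (y.1 + y.2)}, depauwW (x - latticePoint y.1) = _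
  split_ifs with hx
  · rw [tsum_eq_single ⟨nearestCell x, hx.1⟩]
    intro y hy
    by_contra h
    exact hy (Subtype.ext (isActive_and_nearestCell_eq y.2 h).2.symm)
  · convert tsum_zero with y
    by_contra h
    exact hx (isActive_and_nearestCell_eq y.2 h).1

theorem depauwU_latticePoint_add {z : Plane} (hz : supNorm z < 1 / 2) {n : ℤ × ℤ}
    (hn : Even (n.1 + n.2)) : depauwU (latticePoint n + z) = depauwW z := by
  rw [depauwU_eq_ite, if_pos ((isActive_latticePoint_add_iff hz n).2 hn),
    nearestCell_latticePoint_add hz, add_sub_cancel_left]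

theorem norm_depauwW_le (x : Plane) : ‖depauwW x‖ ≤ 4 := by
  refine (norm_le_two_mul_supNorm _).trans ?_
  have : supNorm (depauwW x) ≤ 2 := by
    unfold depauwW
    split_ifs with h1 h2
    · simp [supNorm, abs_mul]; linarith [h1.2]
    · simp [supNorm, abs_mul]; linarith [h2.2]
    · simp [supNorm]
  linarith

theorem norm_depauwU_le (x : Plane) : ‖depauwU x‖ ≤ 4 := by
  classical
  rw [depauwU_eq_ite]
  split_ifs
  · exact norm_depauwW_le _
  · simp

theorem measurable_supNorm : Measurable supNorm := by
  unfold supNorm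
  fun_prop

theorem measurable_round : Measurable (round : ℝ → ℤ) := by
  have : (round : ℝ → ℤ) = fun x => ⌊x + 1 / 2⌋ := funext fun x => round_eq x
  rw [this]
  exact Int.measurable_floor.comp (by fun_prop)

theorem measurable_mk_plane {X : Type*} [MeasurableSpace X] {f g : X → ℝ} (hf : Measurable f)
    (hg : Measurable g) : Measurable fun x => (!₂[f x, g x] : Plane) := by
  refine (WithLp.measurable_toLp 2 (Fin 2 → ℝ)).comp (measurable_pi_lambda _ fun i => ?_)
  fin_cases i
  · exact hf
  · exact hg

theorem measurable_depauwW : Measurable depauwW := by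
  unfold depauwW
  have h0 : Measurable fun x : Plane => x 0 := by fun_prop
  have h1 : Measurable fun x : Plane => x 1 := by fun_prop
  refine Measurable.ite ((measurableSet_lt h1.abs h0.abs).inter
    (measurableSet_lt h0.abs measurable_const)) ?_ (Measurable.ite
    ((measurableSet_lt h0.abs h1.abs).inter (measurableSet_lt h1.abs measurable_const)) ?_ ?_)
  · exact measurable_mk_plane measurable_const (h0.const_mul 4)
  · exact measurable_mk_plane (h1.const_mul (-4)) measurable_const
  · exact measurable_const

theorem measurable_latticePoint_nearestCell :
    Measurable fun x => latticePoint (nearestCell x) := by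
  have h0 : Measurable fun x : Plane => x 0 := by fun_prop
  have h1 : Measurable fun x : Plane => x 1 := by fun_prop
  have hc : Measurable fun n : ℤ => (n : ℝ) := measurable_from_top
  exact measurable_mk_plane (hc.comp (measurable_round.comp h0))
    (hc.comp (measurable_round.comp h1))

theorem measurableSet_isActive : MeasurableSet {x | IsActive x} := by
  have h0 : Measurable fun x : Plane => x 0 := by fun_prop
  have h1 : Measurable fun x : Plane => x 1 := by fun_prop
  have hs : Measurable fun x => (nearestCell x).1 + (nearestCell x).2 :=
    (measurable_round.comp h0).add (measurable_round.comp h1)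
  exact (hs (MeasurableSet.of_discrete (s := {n : ℤ | Even n}))).inter
    (measurableSet_lt (measurable_supNorm.comp
      (measurable_id.sub measurable_latticePoint_nearestCell)) measurable_const)

theorem measurable_depauwU : Measurable depauwU := by
  classical
  rw [funext depauwU_eq_ite]
  exact Measurable.ite measurableSet_isActive
    (measurable_depauwW.comp (measurable_id.sub measurable_latticePoint_nearestCell))
    measurable_const

/-! ### The flow of the periodised field -/

open Classical in
/-- The flow of the autonomous field `depauwU`. -/
noncomputable def cellFlow (τ : ℝ) (x : Plane) : Plane :=
  if IsActive x then
    latticePoint (nearestCell x) + squareFlow τ (x - latticePoint (nearestCell x))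
  else x

theorem cellFlow_latticePoint_add {z : Plane} (hz : supNorm z < 1 / 2) {n : ℤ × ℤ}
    (hn : Even (n.1 + n.2)) (τ : ℝ) :
    cellFlow τ (latticePoint n + z) = latticePoint n + squareFlow τ z := by
  rw [cellFlow, if_pos ((isActive_latticePoint_add_iff hz n).2 hn),
    nearestCell_latticePoint_add hz, add_sub_cancel_left]

theorem cellFlow_of_not_isActive {x : Plane} (hx : ¬ IsActive x) (τ : ℝ) : cellFlow τ x = x :=
  if_neg hx

theorem cellFlow_cellFlow (σ τ : ℝ) (x : Plane) :
    cellFlow σ (cellFlow τ x) = cellFlow (τ + σ) x := by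
  by_cases hx : IsActive x
  · obtain ⟨n, z, hn, hz, rfl⟩ := hx.exists_eq
    rw [cellFlow_latticePoint_add hz hn, cellFlow_latticePoint_add (by rwa [supNorm_squareFlow]) hn,
      cellFlow_latticePoint_add hz hn, squareFlow_squareFlow]
  · simp only [cellFlow_of_not_isActive hx]

theorem cellFlow_zero (x : Plane) : cellFlow 0 x = x := by
  by_cases hx : IsActive x
  · obtain ⟨n, z, hn, hz, rfl⟩ := hx.exists_eq
    rw [cellFlow_latticePoint_add hz hn, squareFlow_zero]
  · exact cellFlow_of_not_isActive hx 0

theorem norm_cellFlow_sub_le (τ : ℝ) (x : Plane) : ‖cellFlow τ x - x‖ ≤ 2 := by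
  by_cases hx : IsActive x
  · obtain ⟨n, z, hn, hz, rfl⟩ := hx.exists_eq
    rw [cellFlow_latticePoint_add hz hn, add_sub_add_left_eq_sub]
    refine (norm_sub_le _ _).trans ?_
    have h1 := norm_le_two_mul_supNorm (squareFlow τ z)
    have h2 := norm_le_two_mul_supNorm z
    rw [supNorm_squareFlow] at h1
    linarith
  · simp [cellFlow_of_not_isActive hx]

theorem measurable_squareFlow : Measurable fun p : ℝ × Plane => squareFlow p.1 p.2 := by
  unfold squareFlow
  exact (measurable_supNorm.comp measurable_snd).smul (continuous_squareCurve.measurable.comp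
    ((measurable_squareAngle.comp measurable_snd).add (measurable_fst.const_mul 4)))

theorem measurable_cellFlow : Measurable fun p : ℝ × Plane => cellFlow p.1 p.2 := by
  classical
  unfold cellFlow
  have h : Measurable fun p : ℝ × Plane => latticePoint (nearestCell p.2) :=
    measurable_latticePoint_nearestCell.comp measurable_snd
  exact Measurable.ite (measurable_snd measurableSet_isActive)
    (h.add (measurable_squareFlow.comp (measurable_fst.prodMk (measurable_snd.sub h))))
    measurable_snd

theorem continuous_squareFlow_left (x : Plane) : Continuous fun τ => squareFlow τ x := by
  have h : Continuous fun τ : ℝ => squareCurve (squareAngle x + 4 * τ) :=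
    continuous_squareCurve.comp (by fun_prop)
  exact h.const_smul (supNorm x)

theorem continuous_cellFlow_left (x : Plane) : Continuous fun τ => cellFlow τ x := by
  by_cases hx : IsActive x
  · obtain ⟨n, z, hn, hz, rfl⟩ := hx.exists_eq
    simp only [cellFlow_latticePoint_add hz hn]
    exact continuous_const.add (continuous_squareFlow_left z)
  · simp only [cellFlow_of_not_isActive hx]
    exact continuous_const

theorem depauwU_of_not_isActive {x : Plane} (hx : ¬ IsActive x) : depauwU x = 0 := by
  classical
  rw [depauwU_eq_ite, if_neg hx]

/-- The exceptional times are those at which the trajectory passes a corner of its square, that is,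
at which its angle is an odd integer. A countable set of them is harmless for the fundamental
theorem of calculus. -/
theorem exists_countable_hasDerivAt_cellFlow (x : Plane) :
    ∃ s : Set ℝ, s.Countable ∧ ∀ τ ∉ s,
      HasDerivAt (fun τ => cellFlow τ x) (depauwU (cellFlow τ x)) τ := by
  by_cases hx : IsActive x
  · obtain ⟨n, z, hn, hz, rfl⟩ := hx.exists_eq
    refine ⟨range fun j : ℤ => (2 * j + 1 - squareAngle z) / 4, countable_range _, fun τ hτ => ?_⟩
    simp only [cellFlow_latticePoint_add hz hn]
    rw [depauwU_latticePoint_add (by rwa [supNorm_squareFlow]) hn]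
    refine (hasDerivAt_squareFlow hz
      (j := round ((squareAngle z + 4 * τ) / 2)) ?_).const_add (latticePoint n)
    refine lt_of_le_of_ne (abs_sub_two_mul_round_le _) fun h => hτ ?_
    generalize round ((squareAngle z + 4 * τ) / 2) = j at h
    rcases eq_or_eq_neg_of_abs_eq h with h | h
    · exact ⟨j, by simp only; linarith⟩
    · exact ⟨j - 1, by push_cast; linarith⟩
  · refine ⟨∅, countable_empty, fun τ _ => ?_⟩
    simp only [cellFlow_of_not_isActive hx]
    rw [depauwU_of_not_isActive hx]
    exact hasDerivAt_const τ x

/-! ### Invariance of area under the flow -/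

/-- A measurable bijection that agrees at every point with one of countably many measure preserving
embeddings is measure preserving. -/
theorem measurePreserving_of_countable_pieces {X ι : Type*} [MeasurableSpace X] [Countable ι]
    {μ : Measure X} (f : X ≃ᵐ X) (e : ι → X → X) (he : ∀ i, MeasurableEmbedding (e i))
    (hp : ∀ i, MeasurePreserving (e i) μ μ) (hm : ∀ i, MeasurableSet {x | f x = e i x})
    (hf : ∀ x, ∃ i, f x = e i x) : MeasurePreserving f μ μ := by
  refine ⟨f.measurable, Measure.ext fun s hs => ?_⟩
  rw [f.map_apply]
  rcases isEmpty_or_nonempty ι with h | h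
  · have : IsEmpty X := ⟨fun x => (hf x).elim fun i _ => h.elim i⟩
    rw [Subsingleton.elim (f ⁻¹' s) s]
  obtain ⟨m, hm0⟩ := exists_surjective_nat ι
  -- The sets of agreement may overlap; making them disjoint yields a partition, and injectivity of
  -- `f` makes the images disjoint too.
  set A : ℕ → Set X := disjointed fun n => {x | f x = e (m n) x} with hA
  have hAm : ∀ n, MeasurableSet (A n) := MeasurableSet.disjointed fun n => hm (m n)
  have hAd : Pairwise (Function.onFun Disjoint A) := disjoint_disjointed _
  have hAu : ⋃ n, A n = univ := by
    rw [hA, iUnion_disjointed]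
    refine eq_univ_of_forall fun x => ?_
    obtain ⟨i, hi⟩ := hf x
    obtain ⟨n, rfl⟩ := hm0 i
    exact mem_iUnion.2 ⟨n, hi⟩
  have hAe : ∀ n, ∀ x ∈ A n, f x = e (m n) x := fun n x hx => disjointed_subset _ n hx
  have h1 : f ⁻¹' s = ⋃ n, f ⁻¹' s ∩ A n := by rw [← inter_iUnion, hAu, inter_univ]
  have h2 : s = ⋃ n, f '' (f ⁻¹' s ∩ A n) := by
    rw [← image_iUnion, ← h1, image_preimage_eq _ f.surjective]
  have h3 : ∀ n, μ (f '' (f ⁻¹' s ∩ A n)) = μ (f ⁻¹' s ∩ A n) := by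
    intro n
    rw [image_congr fun x hx => hAe n x hx.2, ← (hp (m n)).measure_preimage_emb (he (m n)),
      preimage_image_eq _ (he (m n)).injective]
  conv_rhs => rw [h2]
  conv_lhs => rw [h1]
  rw [measure_iUnion, measure_iUnion]
  · exact tsum_congr fun n => (h3 n).symm
  · intro i j hij
    exact (disjoint_image_iff f.injective).2
      ((hAd hij).mono inter_subset_right inter_subset_right)
  · exact fun n => f.measurableEmbedding.measurableSet_image.2
      ((f.measurable hs).inter (hAm n))
  · exact fun i j hij => (hAd hij).mono inter_subset_right inter_subset_right
  · exact fun n => (f.measurable hs).inter (hAm n)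

/-- The linear shear `(x₁, x₂) ↦ (x₁, x₂ + a x₁)`. -/
noncomputable def verticalShear (a : ℝ) : Plane ≃ₗ[ℝ] Plane where
  toFun x := !₂[x 0, x 1 + a * x 0]
  invFun x := !₂[x 0, x 1 - a * x 0]
  map_add' x y := by ext i; fin_cases i <;> simp; ring
  map_smul' c x := by ext i; fin_cases i <;> simp; ring
  left_inv x := by ext i; fin_cases i <;> simp
  right_inv x := by ext i; fin_cases i <;> simp

theorem verticalShear_apply (a : ℝ) (x : Plane) : verticalShear a x = !₂[x 0, x 1 + a * x 0] := rfl

theorem det_verticalShear (a : ℝ) : LinearMap.det (verticalShear a : Plane →ₗ[ℝ] Plane) = 1 := by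
  rw [← LinearMap.det_toMatrix (EuclideanSpace.basisFun (Fin 2) ℝ).toBasis, Matrix.det_fin_two]
  simp [LinearMap.toMatrix_apply, verticalShear_apply]

theorem measurePreserving_verticalShear (a : ℝ) :
    MeasurePreserving (verticalShear a) (volume : Measure Plane) volume := by
  refine ⟨(verticalShear a).toContinuousLinearEquiv.continuous.measurable, ?_⟩
  have h := Measure.map_linearMap_addHaar_eq_smul_addHaar (volume : Measure Plane)
    (f := (verticalShear a : Plane →ₗ[ℝ] Plane)) (by rw [det_verticalShear]; norm_num)
  rw [det_verticalShear] at h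
  simpa using h

/-- The affine pieces of the flow: a shear between two sectors of a cell. -/
noncomputable def sectorMap (τ : ℝ) (i : (ℤ × ℤ) × ℤ × ℤ) (x : Plane) : Plane :=
  latticePoint i.1 + (quarterTurn ^ i.2.2) (verticalShear (4 * τ + 2 * i.2.1 - 2 * i.2.2)
    ((quarterTurn ^ (-i.2.1)) (x - latticePoint i.1)))

theorem measurePreserving_sectorMap (τ : ℝ) (i : (ℤ × ℤ) × ℤ × ℤ) :
    MeasurePreserving (sectorMap τ i) volume volume :=
  (measurePreserving_add_left volume (latticePoint i.1)).comp
    ((quarterTurn ^ i.2.2).measurePreserving.comp ((measurePreserving_verticalShear _).comp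
      ((quarterTurn ^ (-i.2.1)).measurePreserving.comp
        (measurePreserving_sub_right volume (latticePoint i.1)))))

theorem measurableEmbedding_sectorMap (τ : ℝ) (i : (ℤ × ℤ) × ℤ × ℤ) :
    MeasurableEmbedding (sectorMap τ i) :=
  (measurableEmbedding_addLeft (latticePoint i.1)).comp
    ((quarterTurn ^ i.2.2).toHomeomorph.measurableEmbedding.comp
      ((verticalShear _).toContinuousLinearEquiv.toHomeomorph.measurableEmbedding.comp
        ((quarterTurn ^ (-i.2.1)).toHomeomorph.measurableEmbedding.comp
          (MeasurableEquiv.subRight (latticePoint i.1)).measurableEmbedding)))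

/-- Rotate the initial and the final sector to the right-hand one. There the flow sends `r (1, a)`
to `r (1, a + c)`, with `c` depending only on `τ` and the two sectors, which is a linear shear of
determinant one. -/
theorem exists_cellFlow_eq_sectorMap (τ : ℝ) {x : Plane} (hx : IsActive x) :
    ∃ i, cellFlow τ x = sectorMap τ i x := by
  obtain ⟨n, z, hn, hz, rfl⟩ := hx.exists_eq
  refine ⟨(n, round (squareAngle z / 2), round ((squareAngle z + 4 * τ) / 2)), ?_⟩
  have h := supNorm_smul_squareCurve_squareAngle z
  rw [squareCurve, ← map_smul] at h
  have h' : (quarterTurn ^ (-round (squareAngle z / 2))) z =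
      supNorm z • !₂[1, squareAngle z - 2 * round (squareAngle z / 2)] := by
    nth_rw 2 [← h]
    rw [← linearIsometryEquiv_mul_apply, ← zpow_add, neg_add_cancel, zpow_zero]
    rfl
  rw [cellFlow_latticePoint_add hz hn, sectorMap, add_sub_cancel_left, squareFlow, squareCurve, h',
    ← map_smul, verticalShear_apply]
  congr 2
  ext k; fin_cases k <;> simp
  ring

/-- The flow of `depauwU` as a measurable equivalence. -/
noncomputable def cellFlowEquiv (τ : ℝ) : Plane ≃ᵐ Plane where
  toFun := cellFlow τ
  invFun := cellFlow (-τ)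
  left_inv x := by rw [cellFlow_cellFlow, add_neg_cancel, cellFlow_zero]
  right_inv x := by rw [cellFlow_cellFlow, neg_add_cancel, cellFlow_zero]
  measurable_toFun := measurable_cellFlow.comp measurable_prodMk_left
  measurable_invFun := measurable_cellFlow.comp measurable_prodMk_left

theorem measurePreserving_cellFlow (τ : ℝ) : MeasurePreserving (cellFlow τ) volume volume := by
  -- The index `none` stands for the identity, which is the flow at the points that are not active.
  refine measurePreserving_of_countable_pieces (cellFlowEquiv τ)
    (fun i : Option ((ℤ × ℤ) × ℤ × ℤ) => i.elim id (sectorMap τ)) ?_ ?_ ?_ ?_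
  · rintro (_ | i)
    · exact MeasurableEmbedding.id
    · exact measurableEmbedding_sectorMap τ i
  · rintro (_ | i)
    · exact MeasurePreserving.id _
    · exact measurePreserving_sectorMap τ i
  · rintro (_ | i)
    · exact measurableSet_eq_fun (cellFlowEquiv τ).measurable measurable_id
    · exact measurableSet_eq_fun (cellFlowEquiv τ).measurable
        (measurableEmbedding_sectorMap τ i).measurable
  · intro x
    by_cases hx : IsActive x
    · obtain ⟨i, hi⟩ := exists_cellFlow_eq_sectorMap τ hx
      exact ⟨some i, hi⟩
    · exact ⟨none, cellFlow_of_not_isActive hx τ⟩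

/-! ### The continuity equation along a measure preserving flow -/

/-- Boundedness of the support is required in space only, so that functions independent of time are
allowed as well. -/
theorem exists_bound_fderiv_of_spatial_support {φ : ℝ × Plane → ℝ} (hφ : ContDiff ℝ ∞ φ) {R : ℝ}
    (hR : ∀ t x, R ≤ ‖x‖ → φ (t, x) = 0) (V a b : ℝ) :
    ∃ B, 0 ≤ B ∧ ∀ t ∈ Icc a b, ∀ x v : Plane, ‖v‖ ≤ V → ‖fderiv ℝ φ (t, x) (1, v)‖ ≤
      (Metric.closedBall (0 : Plane) R).indicator (fun _ => B) x := by
  have hc : Continuous (fderiv ℝ φ) := hφ.continuous_fderiv (by simp)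
  obtain ⟨B, hB⟩ := (isCompact_Icc.prod (isCompact_closedBall (0 : Plane) R)).exists_bound_of_continuousOn
    (f := fderiv ℝ φ) (s := Icc a b ×ˢ Metric.closedBall (0 : Plane) R) hc.continuousOn
  refine ⟨|B| * max 1 V, by positivity, fun t ht x v hv => ?_⟩
  by_cases hx : ‖x‖ ≤ R
  · have hx' : x ∈ Metric.closedBall (0 : Plane) R := by simpa using hx
    rw [indicator_of_mem hx']
    have h1 := (hB (t, x) ⟨ht, hx'⟩).trans (le_abs_self B)
    refine ((fderiv ℝ φ (t, x)).le_opNorm _).trans (mul_le_mul h1 ?_ (norm_nonneg _)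
      ((norm_nonneg _).trans h1))
    rw [Prod.norm_mk]
    exact max_le_max (by simp) hv
  · have hz : φ =ᶠ[nhds (t, x)] fun _ => 0 := by
      have : ∀ᶠ p : ℝ × Plane in nhds (t, x), R < ‖p.2‖ :=
        continuousAt_const.eventually_lt (continuous_snd.norm.continuousAt) (not_le.1 hx)
      filter_upwards [this] with p hp using hR p.1 p.2 hp.le
    rw [hz.fderiv_eq]
    simp [hx]

/-- A density that is constant along the trajectories of a measure preserving flow solves the
continuity equation on a time interval. -/
theorem integral_transport {a b : ℝ} (hab : a ≤ b) (Ψ : ℝ → Plane ≃ᵐ Plane)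
    (hΨ : Measurable fun p : ℝ × Plane => Ψ p.1 p.2)
    (hp : ∀ t, MeasurePreserving (Ψ t) volume volume)
    (hc : ∀ x, Continuous fun t => Ψ t x) {K : ℝ} (hK : ∀ t x, ‖Ψ t x - x‖ ≤ K)
    {v : Plane → Plane} (hvm : Measurable v) {V : ℝ} (hV : ∀ x, ‖v x‖ ≤ V)
    (hd : ∀ x, ∃ s : Set ℝ, s.Countable ∧ ∀ t ∉ s, HasDerivAt (fun t => Ψ t x) (v (Ψ t x)) t)
    {h : Plane → ℝ} (hm : Measurable h) {M : ℝ} (hM : ∀ x, |h x| ≤ M)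
    {φ : ℝ × Plane → ℝ} (hφ : ContDiff ℝ ∞ φ) {R : ℝ}
    (hR : ∀ t x, R ≤ ‖x‖ → φ (t, x) = 0)
    {ρ : ℝ × Plane → ℝ} (hρ : ∀ t ∈ Ioo a b, ∀ x, ρ (t, Ψ t x) = h x) :
    ∫ t in Ioo a b, ∫ x, ρ (t, x) * fderiv ℝ φ (t, x) (1, v x) =
      (∫ x, h x * φ (b, Ψ b x)) - ∫ x, h x * φ (a, Ψ a x) := by
  have hfc : Continuous (fderiv ℝ φ) := hφ.continuous_fderiv (by simp)
  obtain ⟨B, hB0, hB'⟩ := exists_bound_fderiv_of_spatial_support hφ hR V a b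
  have hB := fun t ht x => hB' t ht x (v x) (hV x)
  set D : ℝ → Plane → ℝ := fun t x => fderiv ℝ φ (t, Ψ t x) (1, v (Ψ t x)) with hD
  have hDm : Measurable fun p : ℝ × Plane => D p.1 p.2 := by
    have h1 : Measurable fun p : ℝ × Plane => fderiv ℝ φ (p.1, Ψ p.1 p.2) :=
      hfc.measurable.comp (measurable_fst.prodMk hΨ)
    have h2 : Measurable fun p : ℝ × Plane => ((1 : ℝ), v (Ψ p.1 p.2)) :=
      measurable_const.prodMk (hvm.comp hΨ)
    have h3 : Continuous fun q : (ℝ × Plane →L[ℝ] ℝ) × (ℝ × Plane) => q.1 q.2 :=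
      isBoundedBilinearMap_apply.continuous
    exact h3.measurable.comp (h1.prodMk h2)
  have hM0 : 0 ≤ M := (abs_nonneg _).trans (hM 0)
  have hDb : ∀ t ∈ Icc a b, ∀ x, ‖h x * D t x‖ ≤
      (Metric.closedBall (0 : Plane) (R + K)).indicator (fun _ => M * B) x := by
    intro t ht x
    have h1 := hB t ht (Ψ t x)
    rw [norm_mul, Real.norm_eq_abs]
    by_cases hx : Ψ t x ∈ Metric.closedBall (0 : Plane) R
    · rw [indicator_of_mem hx] at h1
      have hx' : x ∈ Metric.closedBall (0 : Plane) (R + K) := by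
        simp only [mem_closedBall_zero_iff] at hx ⊢
        have := norm_sub_le (Ψ t x) (Ψ t x - x)
        rw [sub_sub_cancel] at this
        linarith [hK t x]
      rw [indicator_of_mem hx']
      exact mul_le_mul (hM x) h1 (norm_nonneg _) hM0
    · rw [indicator_of_notMem hx] at h1
      rw [le_antisymm h1 (norm_nonneg _), mul_zero]
      exact indicator_nonneg (fun _ _ => by positivity) _
  have hint : Integrable (Function.uncurry fun t x => h x * D t x)
      ((volume.restrict (Ioo a b)).prod volume) := by
    have hg : Integrable (fun p : ℝ × Plane => (1 : ℝ) *
        (Metric.closedBall (0 : Plane) (R + K)).indicator (fun _ => M * B) p.2)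
        ((volume.restrict (Ioo a b)).prod volume) := by
      refine Integrable.mul_prod (f := fun _ : ℝ => (1 : ℝ)) (integrable_const _) ?_
      exact (integrable_indicator_iff Metric.isClosed_closedBall.measurableSet).2
        (integrableOn_const measure_closedBall_lt_top.ne)
    refine hg.mono' ((hm.comp measurable_snd).mul hDm).aestronglyMeasurable ?_
    have : ∀ᵐ p ∂((volume.restrict (Ioo a b)).prod (volume : Measure Plane)), p.1 ∈ Ioo a b :=
      Measure.quasiMeasurePreserving_fst.ae (ae_restrict_mem measurableSet_Ioo)
    filter_upwards [this] with p hp1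
    rw [one_mul]
    exact hDb p.1 (Ioo_subset_Icc_self hp1) p.2
  -- Lagrangian coordinates: substitute `x = Ψ t y` in each time slice.
  have hslice : ∀ t ∈ Ioo a b, ∫ x, ρ (t, x) * fderiv ℝ φ (t, x) (1, v x) = ∫ x, h x * D t x := by
    intro t ht
    rw [← (hp t).integral_comp (Ψ t).measurableEmbedding]
    simp only [hρ t ht, hD]
  -- `D` is the derivative of `φ` along the trajectory of `x`, except at countably many times.
  have htraj : ∀ x, ∫ t in Ioo a b, h x * D t x = h x * φ (b, Ψ b x) - h x * φ (a, Ψ a x) := by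
    intro x
    rw [integral_const_mul, ← mul_sub, ← integral_Ioc_eq_integral_Ioo,
      ← intervalIntegral.integral_of_le hab]
    congr 1
    obtain ⟨s, hs, hs'⟩ := hd x
    have hcurve : Continuous fun t => φ (t, Ψ t x) :=
      hφ.continuous.comp (continuous_id.prodMk (hc x))
    refine integral_eq_of_hasDerivAt_off_countable_of_le (fun t => φ (t, Ψ t x)) (fun t => D t x)
      hab hs hcurve.continuousOn ?_ ?_
    · intro t ht
      exact (hφ.differentiable (by simp) (t, Ψ t x)).hasFDerivAt.comp_hasDerivAt t
        ((hasDerivAt_id t).prodMk (hs' t ht.2))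
    · rw [intervalIntegrable_iff_integrableOn_Icc_of_le hab]
      refine Measure.integrableOn_of_bounded (M := B) measure_Icc_lt_top.ne
        (hDm.comp measurable_prodMk_right).aestronglyMeasurable ?_
      filter_upwards [ae_restrict_mem measurableSet_Icc] with t ht
      refine (hB t ht (Ψ t x)).trans ?_
      by_cases hx : Ψ t x ∈ Metric.closedBall (0 : Plane) R
      · rw [indicator_of_mem hx]
      · rw [indicator_of_notMem hx]; exact hB0
  have hi : ∀ t, Integrable fun x => h x * φ (t, Ψ t x) := by
    intro t
    have h1 : Integrable fun x => φ (t, x) := by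
      refine (hφ.continuous.comp (Continuous.prodMk_right t)).integrable_of_hasCompactSupport ?_
      refine HasCompactSupport.of_support_subset_isCompact (isCompact_closedBall (0 : Plane) R) ?_
      intro x hx
      rw [mem_closedBall_zero_iff]
      by_contra hx'
      exact hx (hR t x (not_le.1 hx').le)
    refine ((hp t).integrable_comp_of_integrable h1).bdd_mul hm.aestronglyMeasurable (c := M) ?_
    exact Filter.Eventually.of_forall hM
  rw [setIntegral_congr_fun measurableSet_Ioo hslice, integral_integral_swap hint]
  simp only [htraj]
  exact integral_sub (hi b) (hi a)

/-! ### Rescaled flows and their composition down to time zero -/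

/-- The flow of the field `x ↦ depauwU (2 ^ k • x)`. -/
noncomputable def scaledFlow (k : ℕ) (τ : ℝ) (x : Plane) : Plane :=
  (1 / 2 : ℝ) ^ k • cellFlow ((2 : ℝ) ^ k * τ) ((2 : ℝ) ^ k • x)

theorem half_pow_smul_two_pow_smul (k : ℕ) (x : Plane) :
    (1 / 2 : ℝ) ^ k • (2 : ℝ) ^ k • x = x := by
  rw [smul_smul, ← mul_pow]; norm_num

theorem two_pow_smul_half_pow_smul (k : ℕ) (x : Plane) :
    (2 : ℝ) ^ k • (1 / 2 : ℝ) ^ k • x = x := by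
  rw [smul_smul, ← mul_pow]; norm_num

theorem two_pow_smul_scaledFlow (k : ℕ) (τ : ℝ) (x : Plane) :
    (2 : ℝ) ^ k • scaledFlow k τ x = cellFlow ((2 : ℝ) ^ k * τ) ((2 : ℝ) ^ k • x) :=
  two_pow_smul_half_pow_smul k _

theorem scaledFlow_scaledFlow (k : ℕ) (σ τ : ℝ) (x : Plane) :
    scaledFlow k σ (scaledFlow k τ x) = scaledFlow k (τ + σ) x := by
  rw [scaledFlow, two_pow_smul_scaledFlow, cellFlow_cellFlow, scaledFlow, mul_add]

theorem scaledFlow_zero (k : ℕ) (x : Plane) : scaledFlow k 0 x = x := by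
  rw [scaledFlow, mul_zero, cellFlow_zero, half_pow_smul_two_pow_smul]

/-- Points stay in their cell, of side `2⁻ᵏ`. Summability of these bounds makes the transport back
to time zero converge. -/
theorem norm_scaledFlow_sub_le (k : ℕ) (τ : ℝ) (x : Plane) :
    ‖scaledFlow k τ x - x‖ ≤ 2 * (1 / 2 : ℝ) ^ k := by
  nth_rw 2 [← half_pow_smul_two_pow_smul k x]
  rw [scaledFlow, ← smul_sub, norm_smul, Real.norm_of_nonneg (by positivity), mul_comm]
  exact mul_le_mul_of_nonneg_right (norm_cellFlow_sub_le _ _) (by positivity)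

theorem measurable_scaledFlow (k : ℕ) : Measurable fun p : ℝ × Plane => scaledFlow k p.1 p.2 :=
  (measurable_cellFlow.comp ((measurable_fst.const_mul _).prodMk
    (measurable_snd.const_smul ((2 : ℝ) ^ k)))).const_smul ((1 / 2 : ℝ) ^ k)

theorem continuous_scaledFlow_left (k : ℕ) (x : Plane) : Continuous fun τ => scaledFlow k τ x := by
  have h : Continuous fun τ : ℝ => cellFlow ((2 : ℝ) ^ k * τ) ((2 : ℝ) ^ k • x) :=
    (continuous_cellFlow_left _).comp (by fun_prop)
  exact h.const_smul ((1 / 2 : ℝ) ^ k)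

theorem exists_countable_hasDerivAt_scaledFlow (k : ℕ) (x : Plane) :
    ∃ s : Set ℝ, s.Countable ∧ ∀ τ ∉ s, HasDerivAt (fun τ => scaledFlow k τ x)
      (depauwU ((2 : ℝ) ^ k • scaledFlow k τ x)) τ := by
  obtain ⟨s, hs, hd⟩ := exists_countable_hasDerivAt_cellFlow ((2 : ℝ) ^ k • x)
  have hk : (2 : ℝ) ^ k ≠ 0 := by positivity
  refine ⟨(fun τ : ℝ => (2 : ℝ) ^ k * τ) ⁻¹' s, hs.preimage (mul_right_injective₀ hk),
    fun τ hτ => ?_⟩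
  have h1 : HasDerivAt (fun τ : ℝ => (2 : ℝ) ^ k * τ) ((2 : ℝ) ^ k) τ := by
    simpa using (hasDerivAt_id τ).const_mul ((2 : ℝ) ^ k)
  have h2 := ((hd _ hτ).scomp τ h1).const_smul ((1 / 2 : ℝ) ^ k)
  rw [half_pow_smul_two_pow_smul] at h2
  rw [two_pow_smul_scaledFlow]
  exact h2

theorem measurable_scaledFlow_right (k : ℕ) (τ : ℝ) : Measurable (scaledFlow k τ) :=
  (measurable_scaledFlow k).comp (g := fun p : ℝ × Plane => scaledFlow k p.1 p.2)
    (f := fun x => (τ, x)) (measurable_const.prodMk measurable_id)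

/-- The flow `scaledFlow` as a measurable equivalence. -/
noncomputable def scaledFlowEquiv (k : ℕ) (τ : ℝ) : Plane ≃ᵐ Plane where
  toFun := scaledFlow k τ
  invFun := scaledFlow k (-τ)
  left_inv x := by rw [scaledFlow_scaledFlow, add_neg_cancel, scaledFlow_zero]
  right_inv x := by rw [scaledFlow_scaledFlow, neg_add_cancel, scaledFlow_zero]
  measurable_toFun := measurable_scaledFlow_right k τ
  measurable_invFun := measurable_scaledFlow_right k (-τ)

theorem scaledFlowEquiv_apply (k : ℕ) (τ : ℝ) (x : Plane) :
    scaledFlowEquiv k τ x = scaledFlow k τ x := rfl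

theorem measurePreserving_scaledFlow (k : ℕ) (τ : ℝ) :
    MeasurePreserving (scaledFlow k τ) volume volume := by
  refine ⟨(scaledFlowEquiv k τ).measurable, ?_⟩
  have h2 : (2 : ℝ) ^ k ≠ 0 := by positivity
  have h1 : (1 / 2 : ℝ) ^ k ≠ 0 := by positivity
  have e : scaledFlow k τ = (fun x : Plane => (1 / 2 : ℝ) ^ k • x) ∘
      cellFlow ((2 : ℝ) ^ k * τ) ∘ fun x : Plane => (2 : ℝ) ^ k • x := rfl
  have hc := measurePreserving_cellFlow ((2 : ℝ) ^ k * τ)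
  rw [e, ← Measure.map_map (measurable_const_smul _) (hc.measurable.comp (measurable_const_smul _)),
    ← Measure.map_map hc.measurable (measurable_const_smul _)]
  have m1 := Measure.map_addHaar_smul (volume : Measure Plane) h1
  have m2 := Measure.map_addHaar_smul (volume : Measure Plane) h2
  -- The Jacobians of the two dilations are inverse to each other.
  rw [m2, Measure.map_smul, hc.map_eq, Measure.map_smul, m1, smul_smul,
    ← ENNReal.ofReal_mul (abs_nonneg _), ← abs_mul, ← mul_inv, ← mul_pow, ← mul_pow]
  norm_num

/-- The transport by Depauw's field from time `2⁻ᵏ` to time `1`. -/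
noncomputable def cascade : ℕ → Plane ≃ᵐ Plane
  | 0 => MeasurableEquiv.refl Plane
  | k + 1 => (scaledFlowEquiv k ((1 / 2 : ℝ) ^ (k + 1))).trans (cascade k)

theorem cascade_zero (x : Plane) : cascade 0 x = x := rfl

theorem cascade_succ (k : ℕ) (x : Plane) :
    cascade (k + 1) x = cascade k (scaledFlow k ((1 / 2 : ℝ) ^ (k + 1)) x) := rfl

theorem cascade_symm_succ (k : ℕ) (x : Plane) :
    (cascade (k + 1)).symm x = scaledFlow k (-(1 / 2 : ℝ) ^ (k + 1)) ((cascade k).symm x) := rfl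

theorem measurePreserving_cascade (k : ℕ) : MeasurePreserving (cascade k) volume volume := by
  induction k with
  | zero => exact MeasurePreserving.id _
  | succ k ih => exact ih.comp (measurePreserving_scaledFlow k _)

theorem dist_cascade_symm_succ_le (x : Plane) (k : ℕ) :
    dist ((cascade k).symm x) ((cascade (k + 1)).symm x) ≤ 2 * (1 / 2 : ℝ) ^ k := by
  rw [dist_comm, cascade_symm_succ, dist_eq_norm]
  exact norm_scaledFlow_sub_le _ _ _

/-- The transport by Depauw's field, backwards from time `1` to time `0`. -/
noncomputable def cascadeLimit (x : Plane) : Plane :=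
  Filter.limUnder Filter.atTop fun k => (cascade k).symm x

theorem tendsto_cascade_symm (x : Plane) :
    Filter.Tendsto (fun k => (cascade k).symm x) Filter.atTop (nhds (cascadeLimit x)) :=
  CauchySeq.tendsto_limUnder
    (cauchySeq_of_le_geometric _ _ (by norm_num) (dist_cascade_symm_succ_le x))

/-- The composition is the transport from time `2⁻ᵏ` back to time zero; the bound is the tail `∑_{i
≥ k} 2 · 2⁻ⁱ`. -/
theorem norm_cascadeLimit_cascade_sub_le (k : ℕ) (x : Plane) :
    ‖cascadeLimit (cascade k x) - x‖ ≤ 4 * (1 / 2 : ℝ) ^ k := by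
  have h := dist_le_of_le_geometric_of_tendsto _ _ (by norm_num)
    (dist_cascade_symm_succ_le (cascade k x)) (tendsto_cascade_symm (cascade k x)) k
  rw [MeasurableEquiv.symm_apply_apply, dist_comm, dist_eq_norm] at h
  refine h.trans_eq ?_
  ring

theorem measurable_cascadeLimit : Measurable cascadeLimit :=
  measurable_of_tendsto_metrizable (fun k => (cascade k).symm.measurable)
    (tendsto_pi_nhds.2 tendsto_cascade_symm)

/-! ### Measure preserving maps of bounded displacement -/

/-- A uniformly bounded displacement preserves boundedness of supports. -/
theorem indicator_closedBall_of_norm_sub_le {f : Plane → ℝ} {R K C : ℝ}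
    (hf : ∀ x, |f x| ≤ (Metric.closedBall (0 : Plane) R).indicator (fun _ => C) x) (hC : 0 ≤ C)
    {x y : Plane} (h : ‖y - x‖ ≤ K) :
    |f y| ≤ (Metric.closedBall (0 : Plane) (R + K)).indicator (fun _ => C) x := by
  have h1 := hf y
  by_cases hy : y ∈ Metric.closedBall (0 : Plane) R
  · rw [indicator_of_mem hy] at h1
    rwa [indicator_of_mem]
    rw [mem_closedBall_zero_iff] at *
    have := norm_sub_le y (y - x)
    rw [sub_sub_cancel] at this
    linarith
  · rw [indicator_of_notMem hy] at h1
    exact h1.trans (indicator_nonneg (fun _ _ => hC) _)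

theorem exists_bound_indicator_of_hasCompactSupport {f : Plane → ℝ} (hf : Continuous f)
    (hs : HasCompactSupport f) :
    ∃ R C, 0 ≤ R ∧ 0 ≤ C ∧
      ∀ x, |f x| ≤ (Metric.closedBall (0 : Plane) R).indicator (fun _ => C) x := by
  obtain ⟨C, hC⟩ := hf.bounded_above_of_compact_support hs
  obtain ⟨R, hR⟩ := hs.isCompact.isBounded.subset_closedBall (0 : Plane)
  refine ⟨max R 0, C, le_max_right _ _, (norm_nonneg _).trans (hC 0), fun x => ?_⟩
  by_cases hx : f x = 0
  · rw [hx, abs_zero]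
    exact indicator_nonneg (fun _ _ => (norm_nonneg _).trans (hC 0)) _
  · rw [indicator_of_mem (Metric.closedBall_subset_closedBall (le_max_left _ _)
      (hR (subset_tsupport _ hx)))]
    exact hC x

theorem integrable_indicator_closedBall_const (R C : ℝ) :
    Integrable ((Metric.closedBall (0 : Plane) R).indicator fun _ => C) :=
  (integrable_indicator_iff Metric.isClosed_closedBall.measurableSet).2
    (integrableOn_const measure_closedBall_lt_top.ne)

/-- A pointwise limit of measure preserving maps of uniformly bounded displacement is measure
preserving. -/
theorem measurePreserving_of_tendsto {T : ℕ → Plane → Plane} {S : Plane → Plane}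
    (hT : ∀ k, MeasurePreserving (T k) volume volume) {K : ℝ} (hK : ∀ k x, ‖T k x - x‖ ≤ K)
    (hS : ∀ x, Filter.Tendsto (fun k => T k x) Filter.atTop (nhds (S x))) :
    MeasurePreserving S volume volume := by
  have hSm : Measurable S :=
    measurable_of_tendsto_metrizable (fun k => (hT k).measurable) (tendsto_pi_nhds.2 hS)
  have hSK : ∀ x, ‖S x - x‖ ≤ K := fun x =>
    le_of_tendsto ((hS x).sub_const x).norm (Filter.Eventually.of_forall fun k => hK k x)
  -- Local finiteness of the image measure lets integrals of compactly supported continuous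
  -- functions determine it; these integrals pass to the limit by dominated convergence.
  have : IsFiniteMeasureOnCompacts (Measure.map S (volume : Measure Plane)) := by
    refine ⟨fun C hC => ?_⟩
    obtain ⟨R, hR⟩ := hC.isBounded.subset_closedBall (0 : Plane)
    rw [Measure.map_apply hSm hC.measurableSet]
    refine (measure_mono (t := Metric.closedBall (0 : Plane) (R + K)) fun x hx => ?_).trans_lt
      measure_closedBall_lt_top
    have h1 := hR hx
    rw [mem_closedBall_zero_iff] at *
    have := norm_sub_le (S x) (S x - x)
    rw [sub_sub_cancel] at this
    linarith [hSK x]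
  refine ⟨hSm, Measure.ext_of_integral_eq_on_compactlySupported fun f => ?_⟩
  change ∫ x, f x ∂_ = ∫ x, f x
  rw [integral_map (f := fun x => f x) hSm.aemeasurable f.continuous.aestronglyMeasurable]
  obtain ⟨R, C, -, hC, hf⟩ := exists_bound_indicator_of_hasCompactSupport f.continuous
    f.hasCompactSupport
  have h1 : Filter.Tendsto (fun k => ∫ x, f (T k x)) Filter.atTop (nhds (∫ x, f (S x))) := by
    refine tendsto_integral_of_dominated_convergence
      ((Metric.closedBall (0 : Plane) (R + K)).indicator fun _ => C)
      (fun k => (f.continuous.measurable.comp (hT k).measurable).aestronglyMeasurable)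
      (integrable_indicator_closedBall_const _ _) ?_ ?_
    · exact fun k => Filter.Eventually.of_forall fun x =>
        indicator_closedBall_of_norm_sub_le hf hC (hK k x)
    · exact Filter.Eventually.of_forall fun x => (f.continuous.tendsto _).comp (hS x)
  have h2 : ∀ k, ∫ x, f (T k x) = ∫ x, f x := by
    intro k
    conv_rhs => rw [← (hT k).map_eq]
    rw [integral_map (f := fun x => f x) (hT k).measurable.aemeasurable
      f.continuous.aestronglyMeasurable]
  simp only [h2] at h1
  exact tendsto_nhds_unique h1 tendsto_const_nhds

theorem measurePreserving_cascadeLimit : MeasurePreserving cascadeLimit volume volume := by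
  refine measurePreserving_of_tendsto (K := 4)
    (fun k => (measurePreserving_cascade k).symm (cascade k)) (fun k x => ?_) tendsto_cascade_symm
  -- `4` is the sum of all the displacements `2 · 2⁻ⁱ`.
  have key : dist ((cascade 0).symm x) ((cascade k).symm x) ≤ 4 := by
    refine (dist_le_range_sum_of_dist_le (f := fun i => (cascade i).symm x) (d := fun i => 2 * (1 / 2 : ℝ) ^ i) k
      fun _ => dist_cascade_symm_succ_le x _).trans ?_
    rw [← Finset.mul_sum, geom_sum_eq (by norm_num)]
    have : 0 < (1 / 2 : ℝ) ^ k := by positivity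
    ring_nf
    linarith
  rw [dist_comm, dist_eq_norm] at key
  exact key

/-- Composition with measure preserving maps that tend to the identity uniformly is continuous in
`L¹`. -/
theorem tendsto_integral_abs_comp_sub {T : ℕ → Plane → Plane}
    (hT : ∀ k, MeasurePreserving (T k) volume volume) {ε : ℕ → ℝ}
    (hε : ∀ k x, ‖T k x - x‖ ≤ ε k) (hε0 : Filter.Tendsto ε Filter.atTop (nhds 0))
    {f : Plane → ℝ} (hf : Integrable f) :
    Filter.Tendsto (fun k => ∫ x, |f (T k x) - f x|) Filter.atTop (nhds 0) := by
  rw [Metric.tendsto_atTop]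
  intro δ hδ
  -- Approximate `f` in `L¹` by a continuous `g` of compact support. The error `f - g` costs at most
  -- `δ/4` both before and after composition, and `g` itself converges pointwise with a common
  -- bound.
  obtain ⟨g, hgs, hfg, hgc, hgi⟩ := hf.exists_hasCompactSupport_integral_sub_le
    (show 0 < δ / 4 by linarith)
  obtain ⟨R, C, -, hC, hgb⟩ := exists_bound_indicator_of_hasCompactSupport hgc hgs
  have hlim : Filter.Tendsto (fun k => ∫ x, |g (T k x) - g x|) Filter.atTop (nhds 0) := by
    obtain ⟨K, hK⟩ := hε0.bddAbove_range
    have hK' : ∀ k x, ‖T k x - x‖ ≤ K := fun k x => (hε k x).trans (hK ⟨k, rfl⟩)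
    have h0 : Filter.Tendsto (fun k => ∫ x, |g (T k x) - g x|) Filter.atTop
        (nhds (∫ _ : Plane, (0 : ℝ))) := by
      refine tendsto_integral_of_dominated_convergence
        (fun x => (Metric.closedBall (0 : Plane) (R + K)).indicator (fun _ => C) x +
          (Metric.closedBall (0 : Plane) R).indicator (fun _ => C) x)
        (fun k => ((hgc.measurable.comp (hT k).measurable).sub
          hgc.measurable).abs.aestronglyMeasurable)
        ((integrable_indicator_closedBall_const _ _).add
          (integrable_indicator_closedBall_const _ _)) ?_ ?_
      · refine fun k => Filter.Eventually.of_forall fun x => ?_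
        rw [Real.norm_eq_abs, abs_abs]
        exact (abs_sub _ _).trans (add_le_add
          (indicator_closedBall_of_norm_sub_le hgb hC (hK' k x)) (hgb x))
      · refine Filter.Eventually.of_forall fun x => ?_
        have h1 : Filter.Tendsto (fun k => T k x) Filter.atTop (nhds x) := by
          rw [tendsto_iff_norm_sub_tendsto_zero]
          exact squeeze_zero (fun _ => norm_nonneg _) (fun k => hε k x) hε0
        have h2 := (((hgc.tendsto x).comp h1).sub_const (g x)).abs
        simpa using h2
    simpa using h0
  obtain ⟨N, hN⟩ := Metric.tendsto_atTop.1 hlim (δ / 4) (by linarith)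
  refine ⟨N, fun k hk => ?_⟩
  have hN' := hN k hk
  rw [Real.dist_0_eq_abs, abs_of_nonneg (integral_nonneg fun _ => abs_nonneg _)] at hN' ⊢
  have i1 : Integrable fun x => |f (T k x) - g (T k x)| :=
    ((hT k).integrable_comp_of_integrable (hf.sub hgi)).abs
  have i2 : Integrable fun x => |g (T k x) - g x| :=
    (((hT k).integrable_comp_of_integrable hgi).sub hgi).abs
  have i3 : Integrable fun x => |f x - g x| := (hf.sub hgi).abs
  have e1 : ∫ x, |f (T k x) - g (T k x)| = ∫ x, |f x - g x| := by
    have := (hT k).map_eq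
    conv_rhs => rw [← this]
    rw [integral_map (hT k).measurable.aemeasurable]
    rw [this]
    exact i3.aestronglyMeasurable
  have hle : ∫ x, |f (T k x) - f x| ≤
      ∫ x, (|f (T k x) - g (T k x)| + |g (T k x) - g x| + |f x - g x|) := by
    refine integral_mono_of_nonneg (Filter.Eventually.of_forall fun _ => abs_nonneg _)
      ((i1.add i2).add i3) (Filter.Eventually.of_forall fun x => ?_)
    have h1 := abs_sub_le (f (T k x)) (g (T k x)) (f x)
    have h2 := abs_sub_le (g (T k x)) (g x) (f x)
    rw [abs_sub_comm (g x) (f x)] at h2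
    simp only
    linarith
  have s1 : ∫ x, (|f (T k x) - g (T k x)| + |g (T k x) - g x| + |f x - g x|) =
      (∫ x, |f (T k x) - g (T k x)|) + (∫ x, |g (T k x) - g x|) + ∫ x, |f x - g x| := by
    have h1 := integral_add (i1.add i2) i3
    simp only [Pi.add_apply] at h1
    rw [h1, integral_add i1 i2]
  simp only [Real.norm_eq_abs] at hfg
  linarith

/-! ### Dyadic times, boundedness and vanishing divergence -/

/-- The index `k` of the interval `(2⁻⁽ᵏ⁺¹⁾, 2⁻ᵏ)` that contains `t`. -/
noncomputable def dyadicLevel (t : ℝ) : ℕ := ⌊-Real.logb 2 t⌋₊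

theorem logb_two_half_pow (k : ℕ) : Real.logb 2 ((1 / 2 : ℝ) ^ k) = -k := by
  rw [Real.logb_pow, one_div, Real.logb_inv, Real.logb_self_eq_one (by norm_num)]
  ring

theorem dyadicLevel_eq {k : ℕ} {t : ℝ} (ht : t ∈ Ioo ((1 / 2 : ℝ) ^ (k + 1)) ((1 / 2 : ℝ) ^ k)) :
    dyadicLevel t = k := by
  have h0 : (0 : ℝ) < (1 / 2 : ℝ) ^ (k + 1) := by positivity
  have h1 := Real.logb_lt_logb (b := 2) (by norm_num) h0 ht.1
  have h2 := Real.logb_lt_logb (b := 2) (by norm_num) (h0.trans ht.1) ht.2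
  rw [logb_two_half_pow] at h1 h2
  push_cast at h1
  have hk : (0 : ℝ) ≤ k := k.cast_nonneg
  rw [dyadicLevel, Nat.floor_eq_iff (by linarith)]
  constructor <;> linarith

theorem measurable_dyadicLevel : Measurable dyadicLevel :=
  Nat.measurable_floor.comp (Real.measurable_log.div_const _).neg

theorem half_pow_le_one (k : ℕ) : (1 / 2 : ℝ) ^ k ≤ 1 := pow_le_one₀ (by norm_num) (by norm_num)

/-- The indicator remains because `dyadicLevel` also has a value at the dyadic times, for `t ≥ 1`
and for `t ≤ 0`, where the field is zero. -/
theorem depauwField_eq_indicator (p : ℝ × Plane) :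
    depauwField p = (Ioo ((1 / 2 : ℝ) ^ (dyadicLevel p.1 + 1)) ((1 / 2 : ℝ) ^ dyadicLevel p.1)).indicator
      (fun _ => depauwU ((2 : ℝ) ^ dyadicLevel p.1 • p.2)) p.1 := by
  rw [depauwField, tsum_eq_single (dyadicLevel p.1)]
  intro k hk
  exact indicator_of_notMem (fun h => hk (dyadicLevel_eq h).symm) _

theorem depauwField_of_mem_Ioo {k : ℕ} {t : ℝ}
    (ht : t ∈ Ioo ((1 / 2 : ℝ) ^ (k + 1)) ((1 / 2 : ℝ) ^ k)) (x : Plane) :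
    depauwField (t, x) = depauwU ((2 : ℝ) ^ k • x) := by
  rw [depauwField_eq_indicator, dyadicLevel_eq ht, indicator_of_mem ht]

theorem depauwField_of_one_le {t : ℝ} (ht : 1 ≤ t) (x : Plane) : depauwField (t, x) = 0 := by
  rw [depauwField_eq_indicator]
  exact indicator_of_notMem (fun h => (h.2.trans_le (half_pow_le_one _)).not_ge ht) _

theorem norm_depauwField_le (p : ℝ × Plane) : ‖depauwField p‖ ≤ 4 := by
  rw [depauwField_eq_indicator]
  exact (norm_indicator_le_norm_self _ _).trans (norm_depauwU_le _)

theorem measurable_comp_dyadicLevel {X : Type*} [MeasurableSpace X] {F : ℕ → ℝ × Plane → X}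
    (hF : ∀ k, Measurable (F k)) : Measurable fun p => F (dyadicLevel p.1) p := by
  have h : Measurable fun q : ℕ × (ℝ × Plane) => F q.1 q.2 :=
    measurable_from_prod_countable_right hF
  exact h.comp ((measurable_dyadicLevel.comp measurable_fst).prodMk measurable_id)

theorem measurable_depauwField : Measurable depauwField := by
  classical
  rw [funext depauwField_eq_indicator]
  refine measurable_comp_dyadicLevel (F := fun k p => (Ioo ((1 / 2 : ℝ) ^ (k + 1))
    ((1 / 2 : ℝ) ^ k)).indicator (fun _ => depauwU ((2 : ℝ) ^ k • p.2)) p.1) fun k => ?_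
  have h : Measurable fun p : ℝ × Plane => depauwU ((2 : ℝ) ^ k • p.2) :=
    measurable_depauwU.comp (measurable_snd.const_smul ((2 : ℝ) ^ k))
  simp only [indicator_apply]
  exact Measurable.ite (measurable_fst measurableSet_Ioo) h measurable_const

theorem isBoundedField_depauwField : IsBoundedField depauwField :=
  ⟨measurable_depauwField, 4, norm_depauwField_le⟩

/-- Almost every time in `(0, 1)` lies in one of the intervals `(2⁻⁽ᵏ⁺¹⁾, 2⁻ᵏ)`. -/
theorem ae_exists_mem_Ioo :
    ∀ᵐ t : ℝ, 0 < t → t < 1 → ∃ k : ℕ, t ∈ Ioo ((1 / 2 : ℝ) ^ (k + 1)) ((1 / 2 : ℝ) ^ k) := by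
  have h := (countable_range fun k : ℕ => (1 / 2 : ℝ) ^ k).ae_notMem (volume : Measure ℝ)
  filter_upwards [h] with t ht h0 h1
  obtain ⟨k, hk1, hk2⟩ := exists_nat_pow_near_of_lt_one h0 h1.le (show (0 : ℝ) < 1 / 2 by norm_num)
    (by norm_num)
  exact ⟨k, hk1, lt_of_le_of_ne hk2 fun h => ht ⟨k, h.symm⟩⟩

/-- Apply `integral_transport` to the density `1` and the time-independent function `ψ` on `[0, 1]`.
The right-hand side is the difference of the integrals of `ψ` composed with two measure preserving
maps, hence zero. -/
theorem integral_fderiv_depauwU_eq_zero (k : ℕ) {ψ : Plane → ℝ} (hψ : ContDiff ℝ ∞ ψ)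
    (hs : HasCompactSupport ψ) : ∫ x, fderiv ℝ ψ x (depauwU ((2 : ℝ) ^ k • x)) = 0 := by
  obtain ⟨R, hR⟩ := hs.isCompact.isBounded.subset_ball (0 : Plane)
  have hφ : ContDiff ℝ ∞ fun p : ℝ × Plane => ψ p.2 := hψ.comp contDiff_snd
  have h := integral_transport (a := 0) (b := 1) zero_le_one (scaledFlowEquiv k)
    (measurable_scaledFlow k) (measurePreserving_scaledFlow k) (continuous_scaledFlow_left k)
    (K := 2 * (1 / 2 : ℝ) ^ k) (norm_scaledFlow_sub_le k)
    (v := fun x => depauwU ((2 : ℝ) ^ k • x)) (measurable_depauwU.comp (measurable_const_smul _))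
    (fun _ => norm_depauwU_le _) (exists_countable_hasDerivAt_scaledFlow k)
    (h := fun _ => 1) measurable_const (M := 1) (fun _ => by simp) hφ (R := R)
    (fun t x hx => by
      by_contra h
      have := hR (subset_tsupport _ h)
      rw [mem_ball_zero_iff] at this
      exact this.not_ge hx)
    (ρ := fun _ => 1) (fun _ _ _ => rfl)
  have e1 : ∀ t, ∫ x, ψ (scaledFlowEquiv k t x) = ∫ x, ψ x := fun t =>
    MeasurePreserving.integral_comp (measurePreserving_scaledFlow k t)
      (scaledFlowEquiv k t).measurableEmbedding _
  have e2 : ∀ t x, fderiv ℝ (fun p : ℝ × Plane => ψ p.2) (t, x) (1, depauwU ((2 : ℝ) ^ k • x)) =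
      fderiv ℝ ψ x (depauwU ((2 : ℝ) ^ k • x)) := by
    intro t x
    have h1 : HasFDerivAt (fun p : ℝ × Plane => ψ p.2)
        ((fderiv ℝ ψ x).comp (ContinuousLinearMap.snd ℝ ℝ Plane)) (t, x) :=
      HasFDerivAt.comp (t, x) (hψ.differentiable (by simp) x).hasFDerivAt hasFDerivAt_snd
    rw [h1.fderiv]
    rfl
  simp only [one_mul, e1, e2, sub_self] at h
  simpa using h

theorem isDivergenceFree_depauwField : IsDivergenceFree depauwField := by
  rw [IsDivergenceFree]
  filter_upwards [ae_restrict_of_ae ae_exists_mem_Ioo, ae_restrict_mem measurableSet_Ioi]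
    with t ht h0 ψ hψ hs
  rcases lt_or_ge t 1 with h1 | h1
  · obtain ⟨k, hk⟩ := ht h0 h1
    simp only [depauwField_of_mem_Ioo hk]
    exact integral_fderiv_depauwU_eq_zero k hψ hs
  · simp [depauwField_of_one_le h1]

/-! ### Densities prescribed at time one -/

/-- The transport by Depauw's field from time `t` to time `1`. -/
noncomputable def toTimeOne (p : ℝ × Plane) : Plane :=
  if 1 ≤ p.1 then p.2
  else cascade (dyadicLevel p.1) (scaledFlow (dyadicLevel p.1) ((1 / 2) ^ dyadicLevel p.1 - p.1) p.2)

theorem measurable_toTimeOne : Measurable toTimeOne := by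
  refine Measurable.ite (measurableSet_le measurable_const measurable_fst) measurable_snd
    (measurable_comp_dyadicLevel
      (F := fun k p => cascade k (scaledFlow k ((1 / 2) ^ k - p.1) p.2)) fun k => ?_)
  exact (cascade k).measurable.comp ((measurable_scaledFlow k).comp
    ((measurable_const.sub measurable_fst).prodMk measurable_snd))

/-- The time already spent in level `k` and the time that remains add up to the full `2⁻⁽ᵏ⁺¹⁾`. Thus
`toTimeOne` is constant along trajectories. -/
theorem toTimeOne_scaledFlow {k : ℕ} {t : ℝ}
    (ht : t ∈ Ioo ((1 / 2 : ℝ) ^ (k + 1)) ((1 / 2 : ℝ) ^ k)) (x : Plane) :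
    toTimeOne (t, scaledFlow k (t - (1 / 2 : ℝ) ^ (k + 1)) x) = cascade (k + 1) x := by
  rw [toTimeOne, if_neg (not_le.2 (ht.2.trans_le (half_pow_le_one k))), cascade_succ]
  simp only [dyadicLevel_eq ht]
  rw [scaledFlow_scaledFlow]
  congr 2
  ring

theorem integral_toTimeOne_Ioo (k : ℕ) {G : Plane → ℝ} (hG : Measurable G) {M : ℝ}
    (hM : ∀ x, |G x| ≤ M) {φ : ℝ × Plane → ℝ} (hφ : ContDiff ℝ ∞ φ) {R : ℝ}
    (hR : ∀ t x, R ≤ ‖x‖ → φ (t, x) = 0) :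
    ∫ t in Ioo ((1 / 2 : ℝ) ^ (k + 1)) ((1 / 2 : ℝ) ^ k),
        ∫ x, G (toTimeOne (t, x)) * fderiv ℝ φ (t, x) (1, depauwField (t, x)) =
      (∫ x, G (cascade k x) * φ ((1 / 2 : ℝ) ^ k, x)) -
        ∫ x, G (cascade (k + 1) x) * φ ((1 / 2 : ℝ) ^ (k + 1), x) := by
  have h := integral_transport (a := (1 / 2 : ℝ) ^ (k + 1)) (b := (1 / 2 : ℝ) ^ k)
    (pow_le_pow_of_le_one (by norm_num) (by norm_num) k.le_succ)
    (fun t => scaledFlowEquiv k (t - (1 / 2 : ℝ) ^ (k + 1)))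
    ((measurable_scaledFlow k).comp ((measurable_fst.sub_const _).prodMk measurable_snd))
    (fun t => measurePreserving_scaledFlow k _)
    (fun x => (continuous_scaledFlow_left k x).comp (continuous_id.sub continuous_const))
    (K := 2 * (1 / 2 : ℝ) ^ k) (fun t => norm_scaledFlow_sub_le k _)
    (v := fun x => depauwU ((2 : ℝ) ^ k • x)) (measurable_depauwU.comp (measurable_const_smul _))
    (fun _ => norm_depauwU_le _)
    (fun x => by
      obtain ⟨s, hs, hd⟩ := exists_countable_hasDerivAt_scaledFlow k x
      refine ⟨(fun t : ℝ => t - (1 / 2 : ℝ) ^ (k + 1)) ⁻¹' s, hs.preimage sub_left_injective,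
        fun t ht => ?_⟩
      have h1 := (hd _ ht).scomp t ((hasDerivAt_id t).sub_const ((1 / 2 : ℝ) ^ (k + 1)))
      rw [one_smul] at h1
      exact h1)
    (h := fun x => G (cascade (k + 1) x)) (hG.comp (cascade (k + 1)).measurable) (M := M)
    (fun _ => hM _) hφ hR (ρ := fun p => G (toTimeOne p))
    (fun t ht x => congrArg G (toTimeOne_scaledFlow ht x))
  simp only [scaledFlowEquiv_apply, sub_self, scaledFlow_zero,
    show (1 / 2 : ℝ) ^ k - (1 / 2 : ℝ) ^ (k + 1) = (1 / 2 : ℝ) ^ (k + 1) by ring,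
    cascade_succ k] at h
  -- At the final time of the level, return from Lagrangian to Eulerian coordinates.
  have e := (measurePreserving_scaledFlow k ((1 / 2 : ℝ) ^ (k + 1))).integral_comp
    (scaledFlowEquiv k ((1 / 2 : ℝ) ^ (k + 1))).measurableEmbedding
    (fun x => G (cascade k x) * φ ((1 / 2 : ℝ) ^ k, x))
  rw [e] at h
  simp only [cascade_succ k]
  rw [← h]
  refine setIntegral_congr_fun measurableSet_Ioo fun t ht => ?_
  simp only [depauwField_of_mem_Ioo ht]

/-- A test function vanishes outside a bounded set of points and outside a bounded set of times. -/
theorem exists_forall_eq_zero_of_hasCompactSupport {φ : ℝ × Plane → ℝ} (hs : HasCompactSupport φ) :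
    ∃ R : ℝ, 1 < R ∧ (∀ t x, R ≤ ‖x‖ → φ (t, x) = 0) ∧ ∀ t x, R ≤ t → φ (t, x) = 0 := by
  obtain ⟨R, hR⟩ := hs.isCompact.isBounded.subset_ball (0 : ℝ × Plane)
  have key : ∀ p : ℝ × Plane, max R 2 ≤ ‖p‖ → φ p = 0 := by
    intro p hp
    by_contra h
    have := hR (subset_tsupport _ h)
    rw [mem_ball_zero_iff] at this
    exact this.not_ge ((le_max_left _ _).trans hp)
  exact ⟨max R 2, one_lt_two.trans_le (le_max_right _ _),
    fun t x hx => key _ (hx.trans (le_max_right _ _)),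
    fun t x ht => key _ ((ht.trans (le_abs_self t)).trans (le_max_left _ _))⟩

theorem fderiv_eq_zero_of_lt_time {φ : ℝ × Plane → ℝ} {R : ℝ}
    (hT : ∀ t x, R ≤ t → φ (t, x) = 0) {t : ℝ} (ht : R < t) (x : Plane) :
    fderiv ℝ φ (t, x) = 0 := by
  have hz : φ =ᶠ[nhds (t, x)] fun _ => 0 := by
    have : ∀ᶠ p : ℝ × Plane in nhds (t, x), R < p.1 :=
      continuousAt_const.eventually_lt continuous_fst.continuousAt ht
    filter_upwards [this] with p hp using hT p.1 p.2 hp.le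
  rw [hz.fderiv_eq]
  simp

theorem integral_toTimeOne_Ioi_one {G : Plane → ℝ} (hG : Measurable G) {M : ℝ}
    (hM : ∀ x, |G x| ≤ M) {φ : ℝ × Plane → ℝ} (hφ : ContDiff ℝ ∞ φ) {R : ℝ} (hR1 : 1 < R)
    (hR : ∀ t x, R ≤ ‖x‖ → φ (t, x) = 0) (hT : ∀ t x, R ≤ t → φ (t, x) = 0) :
    ∫ t in Ioi (1 : ℝ), ∫ x, G (toTimeOne (t, x)) * fderiv ℝ φ (t, x) (1, depauwField (t, x)) =
      - ∫ x, G x * φ (1, x) := by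
  have h := integral_transport hR1.le (fun _ => MeasurableEquiv.refl Plane) measurable_snd
    (fun _ => MeasurePreserving.id _) (fun _ => continuous_const) (K := 0) (fun _ _ => by simp)
    (v := fun _ => 0) measurable_const (V := 0) (fun _ => by simp)
    (fun x => ⟨∅, countable_empty, fun t _ => hasDerivAt_const t x⟩) hG hM hφ hR
    (ρ := fun p => G (toTimeOne p)) (fun t ht x => by
      rw [toTimeOne, if_pos ht.1.le]; rfl)
  have e1 : ∀ x, φ (R, x) = 0 := fun x => hT R x le_rfl
  simp only [MeasurableEquiv.refl_apply, e1, mul_zero, integral_zero, zero_sub] at h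
  rw [← h, ← integral_Ioc_eq_integral_Ioo]
  rw [setIntegral_eq_of_subset_of_forall_sdiff_eq_zero (s := Ioc 1 R) measurableSet_Ioi
    Ioc_subset_Ioi_self]
  · refine setIntegral_congr_fun measurableSet_Ioc fun t ht => ?_
    simp only [depauwField_of_one_le ht.1.le]
  · intro t ht
    have : R < t := by
      by_contra h'
      exact ht.2 ⟨ht.1, not_lt.1 h'⟩
    simp [fderiv_eq_zero_of_lt_time hT this]

/-- Integrability up to time zero permits cutting `(0, ∞)` into levels and letting the lower end
tend to zero. -/
theorem integrable_toTimeOne_mul_fderiv {G : Plane → ℝ} (hG : Measurable G) {M : ℝ}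
    (hM : ∀ x, |G x| ≤ M) {φ : ℝ × Plane → ℝ} (hφ : ContDiff ℝ ∞ φ) {R : ℝ}
    (hR : ∀ t x, R ≤ ‖x‖ → φ (t, x) = 0) (hT : ∀ t x, R ≤ t → φ (t, x) = 0) :
    Integrable (fun p : ℝ × Plane => G (toTimeOne p) * fderiv ℝ φ p (1, depauwField p))
      ((volume.restrict (Ioi (0 : ℝ))).prod volume) := by
  obtain ⟨B, hB0, hB⟩ := exists_bound_fderiv_of_spatial_support hφ hR 4 0 R
  have hM0 : 0 ≤ M := (abs_nonneg _).trans (hM 0)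
  have hfc : Continuous (fderiv ℝ φ) := hφ.continuous_fderiv (by simp)
  have hm : Measurable fun p : ℝ × Plane => fderiv ℝ φ p (1, depauwField p) := by
    have h3 : Continuous fun q : (ℝ × Plane →L[ℝ] ℝ) × (ℝ × Plane) => q.1 q.2 :=
      isBoundedBilinearMap_apply.continuous
    exact h3.measurable.comp
      (hfc.measurable.prodMk (measurable_const.prodMk measurable_depauwField))
  have hg : Integrable (fun p : ℝ × Plane => (Icc 0 R).indicator (fun _ => M) p.1 *
      (Metric.closedBall (0 : Plane) R).indicator (fun _ => B) p.2)
      ((volume.restrict (Ioi (0 : ℝ))).prod volume) := by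
    refine Integrable.mul_prod (f := (Icc 0 R).indicator (fun _ => M)) ?_
      (integrable_indicator_closedBall_const R B)
    refine Integrable.mono_measure (ν := volume) ?_ Measure.restrict_le_self
    exact (integrable_indicator_iff measurableSet_Icc).2 (integrableOn_const measure_Icc_lt_top.ne)
  refine hg.mono' ((hG.comp measurable_toTimeOne).mul hm).aestronglyMeasurable ?_
  have : ∀ᵐ p ∂((volume.restrict (Ioi (0 : ℝ))).prod (volume : Measure Plane)), p.1 ∈ Ioi (0 : ℝ) :=
    Measure.quasiMeasurePreserving_fst.ae (ae_restrict_mem measurableSet_Ioi)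
  filter_upwards [this] with p hp
  rw [norm_mul]
  by_cases hpR : p.1 ≤ R
  · have hp' : p.1 ∈ Icc 0 R := ⟨le_of_lt hp, hpR⟩
    rw [indicator_of_mem hp']
    exact mul_le_mul (hM _) (hB p.1 hp' p.2 _ (norm_depauwField_le p)) (norm_nonneg _) hM0
  · have h0 : fderiv ℝ φ p = 0 := fderiv_eq_zero_of_lt_time hT (not_le.1 hpR) p.2
    rw [h0]
    simp only [zero_apply, norm_zero, mul_zero]
    exact mul_nonneg (indicator_nonneg (fun _ _ => hM0) _) (indicator_nonneg (fun _ _ => hB0) _)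

/-- A bounded density transported by Depauw's field solves the Cauchy problem with the initial
datum to which it converges weakly along the times `2⁻ᵏ`. -/
theorem isBoundedWeakSolution_toTimeOne {G ρ₀ : Plane → ℝ} (hG : Measurable G) {M : ℝ}
    (hM : ∀ x, |G x| ≤ M)
    (hlim : ∀ φ : ℝ × Plane → ℝ, ContDiff ℝ ∞ φ → HasCompactSupport φ →
      Filter.Tendsto (fun k => ∫ x, G (cascade k x) * φ ((1 / 2 : ℝ) ^ k, x)) Filter.atTop
        (nhds (∫ x, ρ₀ x * φ (0, x)))) :
    IsBoundedWeakSolution depauwField ρ₀ fun p => G (toTimeOne p) := by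
  have hM0 : 0 ≤ M := (abs_nonneg _).trans (hM 0)
  refine ⟨⟨(hG.comp measurable_toTimeOne).aestronglyMeasurable, fun T R => ?_, fun φ hφ hs => ?_⟩,
    fun T => ⟨M, Filter.Eventually.of_forall fun p _ => hM _⟩⟩
  · refine ⟨(ENNReal.ofReal M * volume (Metric.ball (0 : Plane) R)).toNNReal,
      Filter.Eventually.of_forall fun t => ?_⟩
    rw [ENNReal.coe_toNNReal (ENNReal.mul_ne_top ENNReal.ofReal_ne_top measure_ball_lt_top.ne),
      ← setLIntegral_const]
    refine lintegral_mono fun x => ?_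
    rw [← ofReal_norm]
    exact ENNReal.ofReal_le_ofReal (hM _)
  · obtain ⟨R, hR1, hR, hT⟩ := exists_forall_eq_zero_of_hasCompactSupport hs
    set A : ℝ → ℝ := fun t =>
      ∫ x, G (toTimeOne (t, x)) * fderiv ℝ φ (t, x) (1, depauwField (t, x)) with hA
    have hAi : IntegrableOn A (Ioi 0) :=
      (integrable_toTimeOne_mul_fderiv hG hM hφ hR hT).integral_prod_left
    -- The boundary terms of successive levels telescope; only the one at time `2⁻ᵏ` survives.
    have hstep : ∀ k : ℕ, ∫ t in Ioi ((1 / 2 : ℝ) ^ k), A t =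
        - ∫ x, G (cascade k x) * φ ((1 / 2 : ℝ) ^ k, x) := by
      intro k
      induction k with
      | zero =>
        simpa only [pow_zero, cascade_zero] using integral_toTimeOne_Ioi_one hG hM hφ hR1 hR hT
      | succ k ih =>
        have hle : (1 / 2 : ℝ) ^ (k + 1) ≤ (1 / 2 : ℝ) ^ k :=
          pow_le_pow_of_le_one (by norm_num) (by norm_num) k.le_succ
        have h0 : (0 : ℝ) ≤ (1 / 2 : ℝ) ^ (k + 1) := by positivity
        rw [← Ioc_union_Ioi_eq_Ioi hle, setIntegral_union (Ioc_disjoint_Ioi le_rfl)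
          measurableSet_Ioi (hAi.mono_set fun t ht => h0.trans_lt ht.1)
          (hAi.mono_set fun t ht => (h0.trans hle).trans_lt ht), ih,
          integral_Ioc_eq_integral_Ioo, integral_toTimeOne_Ioo k hG hM hφ hR]
        ring
    have hU : ⋃ k : ℕ, Ioi ((1 / 2 : ℝ) ^ k) = Ioi 0 := by
      ext t
      simp only [mem_iUnion, mem_Ioi]
      constructor
      · rintro ⟨k, hk⟩
        exact lt_trans (by positivity) hk
      · exact fun ht => exists_pow_lt_of_lt_one ht (by norm_num)
    have h1 := tendsto_setIntegral_of_monotone (μ := volume) (f := A)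
      (s := fun k : ℕ => Ioi ((1 / 2 : ℝ) ^ k)) (fun _ => measurableSet_Ioi)
      (fun i j hij => Ioi_subset_Ioi (pow_le_pow_of_le_one (by norm_num) (by norm_num) hij))
      (by rwa [hU])
    rw [hU] at h1
    simp only [hstep] at h1
    exact tendsto_nhds_unique h1 (hlim φ hφ hs).neg

/-! ### The checkerboard, its refinement and its weak limit -/

/-- The checkerboard function with values `±1` on the unit squares. -/
noncomputable def cellSign (x : Plane) : ℝ := (-1) ^ (⌊x 0⌋ + ⌊x 1⌋)

theorem abs_cellSign (x : Plane) : |cellSign x| = 1 := by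
  rw [cellSign, abs_zpow, abs_neg, abs_one, one_zpow]

theorem measurable_cellSign : Measurable cellSign := by
  have h0 : Measurable fun x : Plane => x 0 := by fun_prop
  have h1 : Measurable fun x : Plane => x 1 := by fun_prop
  have h : Measurable fun n : ℤ => (-1 : ℝ) ^ n := measurable_from_top
  exact h.comp ((Int.measurable_floor.comp h0).add (Int.measurable_floor.comp h1))

theorem cellSign_latticePoint_add (n : ℤ × ℤ) (z : Plane) :
    cellSign (latticePoint n + z) = (-1) ^ (n.1 + n.2) * cellSign z := by
  rw [cellSign, cellSign, ← zpow_add₀ (by norm_num)]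
  simp only [latticePoint, PiLp.add_apply]
  simp only [Matrix.cons_val_zero, Matrix.cons_val_one, Int.floor_intCast_add]
  congr 1; ring

theorem floor_eq_ite_of_abs_lt_one {s : ℝ} (h : |s| < 1) : ⌊s⌋ = if 0 ≤ s then 0 else -1 := by
  rw [abs_lt] at h
  split_ifs with h0
  · exact Int.floor_eq_iff.2 ⟨by simpa using h0, by simpa using h.2⟩
  · exact Int.floor_eq_iff.2 ⟨by push_cast; exact h.1.le, by push_cast; linarith⟩

/-- The floor of a number in `(-1, 1)` depends only on whether it is negative, and doubling
preserves that. -/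
theorem cellSign_two_smul {z : Plane} (hz : supNorm z < 1 / 2) :
    cellSign ((2 : ℝ) • z) = cellSign z := by
  have h0 : |z 0| < 1 / 2 := (le_max_left _ _).trans_lt hz
  have h1 : |z 1| < 1 / 2 := (le_max_right _ _).trans_lt hz
  have key : ∀ s : ℝ, |s| < 1 / 2 → ⌊2 * s⌋ = ⌊s⌋ := by
    intro s hs
    rw [floor_eq_ite_of_abs_lt_one (by linarith : |s| < 1), floor_eq_ite_of_abs_lt_one
      (by rw [abs_mul, abs_two]; linarith)]
    simp
  simp only [cellSign, PiLp.smul_apply, smul_eq_mul, key _ h0, key _ h1]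

/-- A quarter turn moves every quadrant to the next one, of opposite colour. The axis `z 1 = 0` is
excluded because the floor treats `0` as positive. -/
theorem cellSign_quarterTurn {z : Plane} (hz : supNorm z < 1 / 2) (hz1 : z 1 ≠ 0) :
    cellSign (quarterTurn z) = -cellSign z := by
  have h1 : |z 1| < 1 / 2 := (le_max_right _ _).trans_lt hz
  have key : ⌊-z 1⌋ = -1 - ⌊z 1⌋ := by
    rw [floor_eq_ite_of_abs_lt_one (by linarith : |z 1| < 1), floor_eq_ite_of_abs_lt_one
      (by rw [abs_neg]; linarith)]
    rcases lt_or_gt_of_ne hz1 with h | h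
    · rw [if_pos (by linarith), if_neg (by linarith)]; norm_num
    · rw [if_neg (by linarith), if_pos h.le]; norm_num
  have e : cellSign (quarterTurn z) = (-1) ^ ((-1 - 2 * ⌊z 1⌋) + (⌊z 0⌋ + ⌊z 1⌋)) := by
    simp only [cellSign, quarterTurn_apply]
    simp only [Matrix.cons_val_zero, Matrix.cons_val_one, key]
    congr 1; ring
  rw [e, zpow_add₀ (by norm_num), zpow_sub₀ (by norm_num), zpow_mul]
  norm_num [cellSign]

/-- The quarter turn of the active cells refines the checkerboard. -/
theorem cellSign_cellFlow_half {x : Plane} (h : ∀ i, ∀ m : ℤ, 2 * x i ≠ m) :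
    cellSign (cellFlow (1 / 2) x) = -cellSign ((2 : ℝ) • x) := by
  obtain ⟨n, hn⟩ : ∃ n, n = nearestCell x := ⟨_, rfl⟩
  obtain ⟨z, rfl⟩ : ∃ z, x = latticePoint n + z := ⟨x - latticePoint n, by abel⟩
  have hn0 : n.1 = round ((latticePoint n + z) 0) := congrArg Prod.fst hn
  have hn1 : n.2 = round ((latticePoint n + z) 1) := congrArg Prod.snd hn
  have a0 : (latticePoint n + z) 0 = n.1 + z 0 := rfl
  have a1 : (latticePoint n + z) 1 = n.2 + z 1 := rfl
  have key : ∀ (m : ℤ) (s : ℝ), m = round (m + s) → (∀ l : ℤ, 2 * (m + s) ≠ l) →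
      |s| < 1 / 2 ∧ s ≠ 0 := by
    intro m s hm hs
    have h1 := abs_sub_round ((m : ℝ) + s)
    rw [← hm, add_sub_cancel_left] at h1
    refine ⟨lt_of_le_of_ne h1 fun h2 => ?_, fun h2 => ?_⟩
    · rcases eq_or_eq_neg_of_abs_eq h2 with h3 | h3
      · exact hs (2 * m + 1) (by rw [h3]; push_cast; ring)
      · exact hs (2 * m - 1) (by rw [h3]; push_cast; ring)
    · exact hs (2 * m) (by rw [h2]; push_cast; ring)
  obtain ⟨z0, -⟩ := key n.1 (z 0) (a0 ▸ hn0) (a0 ▸ h 0)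
  obtain ⟨z1, z1'⟩ := key n.2 (z 1) (a1 ▸ hn1) (a1 ▸ h 1)
  have hz : supNorm z < 1 / 2 := max_lt z0 z1
  have e : (2 : ℝ) • (latticePoint n + z) = latticePoint (2 * n.1, 2 * n.2) + (2 : ℝ) • z := by
    ext i; fin_cases i <;> simp [latticePoint]
  have e2 : ((-1 : ℝ)) ^ (2 * n.1 + 2 * n.2) = 1 := by
    rw [← mul_add, zpow_mul]; norm_num
  rw [e, cellSign_latticePoint_add, cellSign_two_smul hz, e2, one_mul]
  -- The two kinds of cells give the same result: in an active cell the sign comes from the quarter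
  -- turn, in a passive one from the odd parity of its centre.
  by_cases hE : Even (n.1 + n.2)
  · rw [cellFlow_latticePoint_add hz hE, squareFlow_half, cellSign_latticePoint_add,
      cellSign_quarterTurn hz z1', hE.neg_one_zpow, one_mul]
  · rw [cellFlow_of_not_isActive (by rwa [isActive_latticePoint_add_iff hz]),
      cellSign_latticePoint_add, (Int.not_even_iff_odd.1 hE).neg_one_zpow, neg_one_mul]

theorem ae_forall_apply_notMem {s : Set ℝ} (hs : s.Countable) :
    ∀ᵐ x : Plane, ∀ i, x i ∉ s := by
  rw [ae_all_iff]
  intro i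
  have h1 : Measure.QuasiMeasurePreserving (fun x : Plane => x i) volume volume :=
    (Measure.quasiMeasurePreserving_eval (fun _ : Fin 2 => (volume : Measure ℝ)) i).comp
      (EuclideanSpace.volume_preserving_symm_measurableEquiv_toLp (Fin 2)).quasiMeasurePreserving
  exact h1.ae (hs.ae_notMem volume)

/-- Each level contributes one refinement and one sign. The points omitted at a step have a
coordinate that becomes an integer after multiplication by `2ᵏ⁺¹`, and null sets pull back to null
sets under the flow. -/
theorem ae_cellSign_cascade (k : ℕ) :
    ∀ᵐ x, cellSign (cascade k x) = (-1) ^ k * cellSign ((2 : ℝ) ^ k • x) := by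
  induction k with
  | zero => simp [cascade_zero]
  | succ k ih =>
    have hs : ((fun s : ℝ => 2 * ((2 : ℝ) ^ k * s)) ⁻¹' range ((↑) : ℤ → ℝ)).Countable :=
      (countable_range _).preimage
        ((mul_right_injective₀ two_ne_zero).comp (mul_right_injective₀ (by positivity)))
    filter_upwards [(measurePreserving_scaledFlow k
      ((1 / 2 : ℝ) ^ (k + 1))).quasiMeasurePreserving.ae ih, ae_forall_apply_notMem hs] with x hx hxs
    have e : (2 : ℝ) ^ k * (1 / 2 : ℝ) ^ (k + 1) = 1 / 2 := by
      rw [pow_succ, ← mul_assoc, ← mul_pow]; norm_num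
    rw [cascade_succ, hx, two_pow_smul_scaledFlow, e, cellSign_cellFlow_half, smul_smul,
      ← pow_succ']
    · ring
    · exact fun i m hm => hxs i ⟨m, hm.symm⟩

theorem measurePreserving_translate (v : Plane) :
    MeasurePreserving (fun x : Plane => x + v) volume volume := measurePreserving_add_right volume v

/-- The rescaled checkerboards tend to zero weakly. -/
theorem tendsto_integral_mul_cellSign {f : Plane → ℝ} (hf : Integrable f) :
    Filter.Tendsto (fun k : ℕ => ∫ x, f x * cellSign ((2 : ℝ) ^ k • x)) Filter.atTop (nhds 0) := by
  set e : Plane := !₂[1, 0] with he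
  -- Shifting `x` by `2⁻ᵏ e` reverses the sign of the rescaled checkerboard, so twice the integral
  -- is bounded by the `L¹` modulus of continuity of `f`.
  have hes : ∀ y, cellSign (y + e) = -cellSign y := by
    intro y
    have h1 : e = latticePoint (1, 0) := by ext i; fin_cases i <;> simp [he, latticePoint]
    rw [h1, add_comm, cellSign_latticePoint_add]
    norm_num
  have hgm : ∀ k : ℕ, Measurable fun x : Plane => cellSign ((2 : ℝ) ^ k • x) := fun k =>
    measurable_cellSign.comp (measurable_const_smul ((2 : ℝ) ^ k))
  have hi : ∀ (k : ℕ) (u : Plane → ℝ), Integrable u →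
      Integrable fun x => u x * cellSign ((2 : ℝ) ^ k • x) := fun k u hu =>
    hu.mul_bdd (hgm k).aestronglyMeasurable (c := 1)
      (Filter.Eventually.of_forall fun x => (abs_cellSign _).le)
  have hlim := tendsto_integral_abs_comp_sub
    (T := fun k x => x + (1 / 2 : ℝ) ^ k • e) (fun k => measurePreserving_translate _)
    (ε := fun k => (1 / 2 : ℝ) ^ k * ‖e‖) (fun k x => by
      rw [add_sub_cancel_left, norm_smul, Real.norm_of_nonneg (by positivity)])
    (by simpa using (tendsto_pow_atTop_nhds_zero_of_lt_one (r := (1 / 2 : ℝ)) (by norm_num)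
      (by norm_num)).mul_const ‖e‖) hf
  refine squeeze_zero_norm (fun k => ?_) hlim
  set v := (1 / 2 : ℝ) ^ k • e with hv
  have h1 : ∫ x, f x * cellSign ((2 : ℝ) ^ k • x) =
      - ∫ x, f (x + v) * cellSign ((2 : ℝ) ^ k • x) := by
    rw [← integral_add_right_eq_self (fun x => f x * cellSign ((2 : ℝ) ^ k • x)) v, ← integral_neg]
    refine integral_congr_ae (Filter.Eventually.of_forall fun x => ?_)
    simp only
    rw [smul_add, hv, two_pow_smul_half_pow_smul, hes, mul_neg]
  have h2 : ∫ x, (f (x + v) - f x) * cellSign ((2 : ℝ) ^ k • x) =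
      (∫ x, f (x + v) * cellSign ((2 : ℝ) ^ k • x)) - ∫ x, f x * cellSign ((2 : ℝ) ^ k • x) := by
    rw [← integral_sub (hi k _ (hf.comp_add_right v)) (hi k _ hf)]
    simp only [sub_mul]
  have h3 : |∫ x, (f (x + v) - f x) * cellSign ((2 : ℝ) ^ k • x)| ≤ ∫ x, |f (x + v) - f x| := by
    refine (abs_integral_le_integral_abs).trans_eq ?_
    simp only [abs_mul, abs_cellSign, mul_one]
  have h4 : 0 ≤ ∫ x, |f (x + v) - f x| := integral_nonneg fun x => abs_nonneg _
  rw [Real.norm_eq_abs]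
  refine le_trans ?_ h3
  rw [h2]
  have h5 : (∫ x, f (x + v) * cellSign ((2 : ℝ) ^ k • x)) - ∫ x, f x * cellSign ((2 : ℝ) ^ k • x) =
      -(2 * ∫ x, f x * cellSign ((2 : ℝ) ^ k • x)) := by linarith
  rw [h5, abs_neg, abs_mul, abs_two]
  linarith [abs_nonneg (∫ x, f x * cellSign ((2 : ℝ) ^ k • x))]

/-! ### Construction of distinct solutions -/

theorem integrable_bounded_mul_compactSupport {f g : Plane → ℝ} (hf : Measurable f) {M : ℝ}
    (hM : ∀ x, |f x| ≤ M) (hg : Continuous g) (hs : HasCompactSupport g) :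
    Integrable fun x => f x * g x :=
  (hg.integrable_of_hasCompactSupport hs).bdd_mul hf.aestronglyMeasurable (c := M)
    (Filter.Eventually.of_forall hM)

/-- A bounded function composed with measure preserving maps that tend to the identity uniformly
may be replaced by the function itself in integrals against bounded sequences. -/
theorem tendsto_integral_comp_mul_sub {T : ℕ → Plane → Plane}
    (hT : ∀ k, MeasurePreserving (T k) volume volume) {ε : ℕ → ℝ}
    (hε : ∀ k x, ‖T k x - x‖ ≤ ε k) (hε0 : Filter.Tendsto ε Filter.atTop (nhds 0))
    {F : Plane → ℝ} (hF : Measurable F) {M : ℝ} (hM : ∀ x, |F x| ≤ M)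
    {g : ℕ → Plane → ℝ} (hg : ∀ k, Measurable (g k)) (hg1 : ∀ k x, |g k x| ≤ 1)
    {φ : ℝ × Plane → ℝ} (hφ : Continuous φ) (hs : HasCompactSupport φ) {τ : ℕ → ℝ}
    (hτ : Filter.Tendsto τ Filter.atTop (nhds 0)) :
    Filter.Tendsto (fun k => (∫ x, F (T k x) * g k x * φ (τ k, x)) -
      ∫ x, F x * g k x * φ (0, x)) Filter.atTop (nhds 0) := by
  obtain ⟨R, -, hR, -⟩ := exists_forall_eq_zero_of_hasCompactSupport hs
  obtain ⟨C, hC⟩ := hφ.bounded_above_of_compact_support hs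
  obtain ⟨K, hK⟩ := hε0.bddAbove_range
  have hK' : ∀ k x, ‖T k x - x‖ ≤ K := fun k x => (hε k x).trans (hK ⟨k, rfl⟩)
  have hC0 : 0 ≤ C := (norm_nonneg _).trans (hC 0)
  have hM0 : 0 ≤ M := (abs_nonneg _).trans (hM 0)
  -- The cut-off makes `F` integrable. The radius `R + K` ensures that `x` and `T k x` both lie in
  -- `B` whenever `φ` does not vanish at `x`.
  set B := Metric.closedBall (0 : Plane) (R + K) with hB
  have hF1 : Integrable (B.indicator F) := by
    refine (integrable_indicator_closedBall_const (R + K) M).mono'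
      (hF.indicator Metric.isClosed_closedBall.measurableSet).aestronglyMeasurable
      (Filter.Eventually.of_forall fun x => ?_)
    rw [norm_indicator_eq_indicator_norm]
    exact indicator_le_indicator (hM x)
  have hcs : ∀ t, HasCompactSupport fun x => φ (t, x) := by
    intro t
    refine HasCompactSupport.of_support_subset_isCompact (isCompact_closedBall (0 : Plane) R) ?_
    intro x hx
    rw [mem_closedBall_zero_iff]
    by_contra hx'
    exact hx (hR t x (not_le.1 hx').le)
  have hct : ∀ t, Continuous fun x => φ (t, x) := fun t => hφ.comp (Continuous.prodMk_right t)
  have h1 := (tendsto_integral_abs_comp_sub hT hε hε0 hF1).mul_const C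
  have h2 : Filter.Tendsto (fun k => ∫ x, M * |φ (τ k, x) - φ (0, x)|) Filter.atTop
      (nhds (∫ _ : Plane, (0 : ℝ))) := by
    refine tendsto_integral_of_dominated_convergence
      ((Metric.closedBall (0 : Plane) R).indicator fun _ => M * (C + C))
      (fun k => (((hct _).sub (hct 0)).abs.const_smul M).aestronglyMeasurable)
      (integrable_indicator_closedBall_const _ _) ?_ ?_
    · refine fun k => Filter.Eventually.of_forall fun x => ?_
      by_cases hx : ‖x‖ ≤ R
      · rw [indicator_of_mem (mem_closedBall_zero_iff.2 hx), norm_mul, Real.norm_of_nonneg hM0,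
          Real.norm_eq_abs, abs_abs]
        exact mul_le_mul_of_nonneg_left ((abs_sub _ _).trans (add_le_add (hC _) (hC _))) hM0
      · rw [indicator_of_notMem (by simpa using hx), hR _ x (not_le.1 hx).le,
          hR _ x (not_le.1 hx).le]
        simp
    · refine Filter.Eventually.of_forall fun x => ?_
      have h3 : Filter.Tendsto (fun k => φ (τ k, x)) Filter.atTop (nhds (φ (0, x))) :=
        ((hφ.comp (Continuous.prodMk_left x)).tendsto 0).comp hτ
      simpa using ((h3.sub_const (φ (0, x))).abs).const_mul M
  have h12 := h1.add h2
  rw [zero_mul, integral_zero, add_zero] at h12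
  refine squeeze_zero_norm (fun k => ?_) h12
  have b1 : ∀ x, |F (T k x) * g k x| ≤ M := fun x => by
    rw [abs_mul]
    exact (mul_le_mul (hM _) (hg1 k x) (abs_nonneg _) hM0).trans_eq (mul_one M)
  have b2 : ∀ x, |F x * g k x| ≤ M := fun x => by
    rw [abs_mul]
    exact (mul_le_mul (hM _) (hg1 k x) (abs_nonneg _) hM0).trans_eq (mul_one M)
  have j1 := integrable_bounded_mul_compactSupport ((hF.comp (hT k).measurable).mul (hg k)) b1
    (hct (τ k)) (hcs (τ k))
  have j2 := integrable_bounded_mul_compactSupport (hF.mul (hg k)) b2 (hct 0) (hcs 0)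
  have j3 : Integrable fun x => |B.indicator F (T k x) - B.indicator F x| * C :=
    (((hT k).integrable_comp_of_integrable hF1).sub hF1).abs.mul_const C
  have j4 : Integrable fun x => M * |φ (τ k, x) - φ (0, x)| :=
    ((((hct (τ k)).integrable_of_hasCompactSupport (hcs _)).sub
      ((hct 0).integrable_of_hasCompactSupport (hcs 0))).abs).const_mul M
  have s1 := integral_sub j1 j2
  simp only [Pi.mul_apply, Function.comp_apply] at s1
  rw [← s1, ← integral_mul_const, ← integral_add j3 j4]
  refine norm_integral_le_of_norm_le (j3.add j4) (Filter.Eventually.of_forall fun x => ?_)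
  by_cases hx : ‖x‖ ≤ R
  · have m1 : x ∈ B := by
      rw [hB, mem_closedBall_zero_iff]
      linarith [(norm_nonneg _).trans (hK' k x)]
    have m2 : T k x ∈ B := by
      rw [hB, mem_closedBall_zero_iff]
      have h3 : ‖T k x‖ ≤ ‖x‖ + ‖T k x - x‖ := by
        simpa using norm_add_le x (T k x - x)
      linarith [hK' k x]
    rw [indicator_of_mem m1, indicator_of_mem m2, Real.norm_eq_abs]
    have e : F (T k x) * g k x * φ (τ k, x) - F x * g k x * φ (0, x) =
        (F (T k x) - F x) * (g k x * φ (τ k, x)) + F x * g k x * (φ (τ k, x) - φ (0, x)) := by ring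
    rw [e]
    refine (abs_add_le _ _).trans (add_le_add ?_ ?_)
    · rw [abs_mul]
      refine mul_le_mul_of_nonneg_left ?_ (abs_nonneg _)
      rw [abs_mul]
      exact (mul_le_mul (hg1 k x) (hC _) (abs_nonneg _) zero_le_one).trans_eq (one_mul C)
    · rw [abs_mul]
      exact mul_le_mul_of_nonneg_right (b2 x) (abs_nonneg _)
  · rw [hR _ x (not_le.1 hx).le, hR _ x (not_le.1 hx).le]
    simp only [mul_zero, sub_self, norm_zero, abs_zero, add_zero]
    positivity

/-- Transport backwards to time zero, superposed with a modulated checkerboard, yields solutions. -/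
theorem isBoundedWeakSolution_cascadeLimit_add {F H ρ₀ : Plane → ℝ} (hF : Measurable F)
    (hH : Measurable H) {M : ℝ} (hFM : ∀ x, |F x| ≤ M) (hHM : ∀ x, |H x| ≤ M)
    (hρ : F =ᵐ[volume] ρ₀) :
    IsBoundedWeakSolution depauwField ρ₀ fun p =>
      F (cascadeLimit (toTimeOne p)) + H (cascadeLimit (toTimeOne p)) * cellSign (toTimeOne p) := by
  refine isBoundedWeakSolution_toTimeOne
    (G := fun x => F (cascadeLimit x) + H (cascadeLimit x) * cellSign x)
    ((hF.comp measurable_cascadeLimit).add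
      ((hH.comp measurable_cascadeLimit).mul measurable_cellSign)) (M := M + M) (fun x => ?_)
    (fun φ hφ hs => ?_)
  · refine (abs_add_le _ _).trans (add_le_add (hFM _) ?_)
    rw [abs_mul, abs_cellSign, mul_one]
    exact hHM _
  have hT : ∀ k, MeasurePreserving (fun x => cascadeLimit (cascade k x)) volume volume := fun k =>
    measurePreserving_cascadeLimit.comp (measurePreserving_cascade k)
  have hτ : Filter.Tendsto (fun k : ℕ => (1 / 2 : ℝ) ^ k) Filter.atTop (nhds 0) :=
    tendsto_pow_atTop_nhds_zero_of_lt_one (by norm_num) (by norm_num)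
  have hε : Filter.Tendsto (fun k : ℕ => 4 * (1 / 2 : ℝ) ^ k) Filter.atTop (nhds 0) := by
    simpa using hτ.const_mul 4
  -- In both terms the transported amplitude may be replaced by the amplitude itself, in the second
  -- one uniformly against the oscillating sign.
  have l1 := tendsto_integral_comp_mul_sub hT norm_cascadeLimit_cascade_sub_le hε hF hFM
    (g := fun _ _ => 1) (fun _ => measurable_const) (fun _ _ => by simp) hφ.continuous hs hτ
  have l2 := tendsto_integral_comp_mul_sub hT norm_cascadeLimit_cascade_sub_le hε hH hHM
    (g := fun k x => cellSign (cascade k x))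
    (fun k => measurable_cellSign.comp (cascade k).measurable) (fun _ _ => (abs_cellSign _).le)
    hφ.continuous hs hτ
  have hct : ∀ t, Continuous fun x => φ (t, x) := fun t =>
    hφ.continuous.comp (Continuous.prodMk_right t)
  have hcs : ∀ t, HasCompactSupport fun x => φ (t, x) := fun t =>
    hs.comp_isClosedEmbedding (Isometry.isClosedEmbedding (f := fun x : Plane => (t, x))
      (Isometry.of_dist_eq fun x y => by simp [Prod.dist_eq]))
  have l3 : Filter.Tendsto (fun k : ℕ => ∫ x, H x * cellSign (cascade k x) * φ (0, x)) Filter.atTop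
      (nhds 0) := by
    have h1 := tendsto_integral_mul_cellSign
      (integrable_bounded_mul_compactSupport hH hHM (hct 0) (hcs 0))
    refine squeeze_zero_norm (fun k => ?_) (by simpa using h1.norm)
    -- The alternating factor `(-1) ^ k` is harmless since the limit is zero.
    have h2 : ∫ x, H x * cellSign (cascade k x) * φ (0, x) =
        (-1) ^ k * ∫ x, H x * φ (0, x) * cellSign ((2 : ℝ) ^ k • x) := by
      rw [← integral_const_mul]
      refine integral_congr_ae ?_
      filter_upwards [ae_cellSign_cascade k] with x hx
      rw [hx]; ring
    rw [h2, norm_mul, norm_pow, norm_neg, norm_one, one_pow, one_mul]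
    exact le_rfl
  have l4 := (l1.add (l2.add l3)).add_const (∫ x, F x * φ (0, x))
  simp only [mul_one, zero_add, add_zero, sub_add_cancel] at l4
  have hr : ∫ x, ρ₀ x * φ (0, x) = ∫ x, F x * φ (0, x) :=
    integral_congr_ae (hρ.mono fun x hx => by simp only [hx])
  rw [hr]
  refine l4.congr fun k => ?_
  rw [add_right_comm, sub_add_cancel, ← integral_add]
  · refine integral_congr_ae (Filter.Eventually.of_forall fun x => ?_)
    simp only
    ring
  · exact integrable_bounded_mul_compactSupport (hF.comp (hT k).measurable) (fun _ => hFM _)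
      (hct _) (hcs _)
  · exact integrable_bounded_mul_compactSupport ((hH.comp (hT k).measurable).mul
      (measurable_cellSign.comp (cascade k).measurable)) (fun x => by
        rw [abs_mul, abs_cellSign, mul_one]
        exact hHM _) (hct _) (hcs _)

/-- After time one nothing moves, and the difference of the densities is `(H ∘ cascadeLimit) ·
cellSign`. If it vanished, so would `H ∘ cascadeLimit` on a time slice, and then `H` itself, as
`cascadeLimit` preserves measure. The factor `0` keeps the shape of the solution with `H = 0`. -/
theorem not_ae_eq_of_not_ae_eq_zero {F H : Plane → ℝ} (hH : Measurable H)
    (h0 : ¬ H =ᵐ[volume] 0) :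
    ¬ (fun p => F (cascadeLimit (toTimeOne p)) + 0 * cellSign (toTimeOne p))
      =ᵐ[spaceTimeMeasure 2] fun p =>
      F (cascadeLimit (toTimeOne p)) + H (cascadeLimit (toTimeOne p)) * cellSign (toTimeOne p) := by
  intro h
  apply h0
  have h1 : ∀ᵐ p ∂((volume.restrict (Ioi (1 : ℝ))).prod (volume : Measure Plane)),
      H (cascadeLimit (toTimeOne p)) = 0 := by
    have h2 : (volume.restrict (Ioi (1 : ℝ))).prod (volume : Measure Plane) =
        volume.restrict (Ioi (1 : ℝ) ×ˢ (univ : Set Plane)) := by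
      rw [Measure.volume_eq_prod, ← Measure.prod_restrict, Measure.restrict_univ]
    rw [h2]
    have h5 := Filter.Eventually.filter_mono (ae_mono (Measure.restrict_mono
      (prod_mono (Ioi_subset_Ici zero_le_one) (subset_refl (univ : Set Plane))) le_rfl)) h
    filter_upwards [h5] with p hp
    have h3 : H (cascadeLimit (toTimeOne p)) * cellSign (toTimeOne p) = 0 := by
      simp only [zero_mul, add_zero] at hp
      linarith
    have h4 : cellSign (toTimeOne p) ≠ 0 := fun h5 => by
      have := abs_cellSign (toTimeOne p)
      rw [h5, abs_zero] at this
      exact zero_ne_one this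
    exact (mul_eq_zero.1 h3).resolve_right h4
  have h2 := (Measure.ae_ae_of_ae_prod h1).and (ae_restrict_mem measurableSet_Ioi)
  have : (ae (volume.restrict (Ioi (1 : ℝ)))).NeBot := by
    rw [ae_neBot, Ne, Measure.restrict_eq_zero]
    simp
  obtain ⟨t, ht, ht1⟩ := h2.exists
  have h3 : ∀ᵐ x : Plane, H (cascadeLimit x) = 0 := by
    filter_upwards [ht] with x hx
    rwa [toTimeOne, if_pos (le_of_lt ht1)] at hx
  have h4 := (ae_map_iff measurable_cascadeLimit.aemeasurable
    (measurableSet_eq_fun hH measurable_const)).2 h3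
  rwa [measurePreserving_cascadeLimit.map_eq] at h4

/-- Bound and sign are enforced at every point by setting the representative to zero where they
fail. The requirement `1 ≤ M` admits the constant amplitude `H = 1` with the same bound. -/
theorem exists_bounded_measurable_representative {ρ₀ : Plane → ℝ} (h : MemLp ρ₀ ⊤ volume) :
    ∃ (F : Plane → ℝ) (M : ℝ), Measurable F ∧ 1 ≤ M ∧ (∀ x, |F x| ≤ M) ∧ F =ᵐ[volume] ρ₀ ∧
      (0 ≤ᵐ[volume] ρ₀ → ∀ x, 0 ≤ F x) := by
  classical
  obtain ⟨C, hC⟩ : ∃ C : ℝ, ∀ᵐ x, |ρ₀ x| ≤ C := by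
    refine ⟨(eLpNormEssSup ρ₀ volume).toReal, ?_⟩
    have h1 : eLpNormEssSup ρ₀ volume ≠ ⊤ := by
      rw [← eLpNorm_exponent_top]; exact h.2.ne
    filter_upwards [ae_le_eLpNormEssSup (f := ρ₀) (μ := volume)] with x hx
    have := ENNReal.toReal_mono h1 hx
    simpa using this
  set g := h.1.mk ρ₀ with hg
  have hgm : Measurable g := h.1.stronglyMeasurable_mk.measurable
  have hge : ρ₀ =ᵐ[volume] g := h.1.ae_eq_mk
  set P : Plane → Prop := fun x => |g x| ≤ max C 1 ∧ (0 ≤ᵐ[volume] ρ₀ → 0 ≤ g x) with hP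
  have hPm : MeasurableSet {x | P x} := by
    have h2 : MeasurableSet {x | 0 ≤ᵐ[volume] ρ₀ → 0 ≤ g x} := by
      by_cases hp : 0 ≤ᵐ[volume] ρ₀
      · simpa only [hp, forall_true_left] using
          measurableSet_le (f := fun _ => (0 : ℝ)) measurable_const hgm
      · simp only [hp, false_imp_iff, ofPred_true, MeasurableSet.univ]
    exact (measurableSet_le hgm.abs measurable_const).inter h2
  refine ⟨fun x => if P x then g x else 0, max C 1, Measurable.ite hPm hgm measurable_const,
    le_max_right _ _, fun x => ?_, ?_, fun hp x => ?_⟩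
  · simp only
    split_ifs with hx
    · exact hx.1
    · rw [abs_zero]; positivity
  · have hn : ∀ᵐ x, 0 ≤ᵐ[volume] ρ₀ → 0 ≤ ρ₀ x := by
      by_cases hp : 0 ≤ᵐ[volume] ρ₀
      · exact hp.mono fun x hx _ => hx
      · exact Filter.Eventually.of_forall fun x hx => absurd hx hp
    filter_upwards [hC, hge, hn] with x h1 h2 h3
    rw [h2] at h1 h3 ⊢
    exact if_pos ⟨h1.trans (le_max_left _ _), h3⟩
  · simp only
    split_ifs with hx
    · exact hx.2 hp
    · exact le_rfl

theorem exists_two_solutions {ρ₀ : Plane → ℝ} (h : MemLp ρ₀ ⊤ volume) :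
    (∃ ρ₁ ρ₂ : ℝ × Plane → ℝ,
      IsBoundedWeakSolution depauwField ρ₀ ρ₁ ∧ IsBoundedWeakSolution depauwField ρ₀ ρ₂ ∧
      ¬ ρ₁ =ᵐ[spaceTimeMeasure 2] ρ₂) ∧
    (0 ≤ᵐ[volume] ρ₀ → ¬ ρ₀ =ᵐ[volume] 0 →
      ∃ ρ₁ ρ₂ : ℝ × Plane → ℝ,
        IsBoundedWeakSolution depauwField ρ₀ ρ₁ ∧ 0 ≤ᵐ[spaceTimeMeasure 2] ρ₁ ∧
        IsBoundedWeakSolution depauwField ρ₀ ρ₂ ∧ 0 ≤ᵐ[spaceTimeMeasure 2] ρ₂ ∧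
        ¬ ρ₁ =ᵐ[spaceTimeMeasure 2] ρ₂) := by
  obtain ⟨F, M, hF, hM1, hFM, hFρ, hF0⟩ := exists_bounded_measurable_representative h
  have hM0 : 0 ≤ M := zero_le_one.trans hM1
  have s0 := isBoundedWeakSolution_cascadeLimit_add hF (H := fun _ => 0) measurable_const hFM
    (fun _ => by simpa using hM0) hFρ
  refine ⟨⟨_, _, s0, isBoundedWeakSolution_cascadeLimit_add hF (H := fun _ => 1) measurable_const
    hFM (fun _ => by simpa using hM1) hFρ, ?_⟩, fun hp hne => ⟨_, _, s0, ?_,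
    isBoundedWeakSolution_cascadeLimit_add hF hF hFM hFM hFρ, ?_, ?_⟩⟩
  · refine not_ae_eq_of_not_ae_eq_zero (F := F) (H := fun _ => 1) measurable_const fun h1 => ?_
    obtain ⟨x, hx⟩ := h1.exists
    exact one_ne_zero hx
  · refine Filter.Eventually.of_forall fun p => ?_
    simpa using hF0 hp _
  · refine Filter.Eventually.of_forall fun p => ?_
    have h1 := hF0 hp (cascadeLimit (toTimeOne p))
    have h2 := neg_le_of_abs_le (abs_cellSign (toTimeOne p)).le
    simp only [Pi.zero_apply]
    -- The density is `F · (1 + cellSign)` along the flow, with `cellSign ≥ -1`.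
    nlinarith
  · exact not_ae_eq_of_not_ae_eq_zero hF fun h1 => hne (hFρ.symm.trans h1)

/-! ### Bounded variation of the field -/

/-- The function `(a, b) ↦ a` cut off to two triangles of the unit square, which gives the
components of `depauwW`. -/
noncomputable def triangleRamp (p : ℝ × ℝ) : ℝ := if |p.2| < |p.1| ∧ |p.1| < 1 / 2 then p.1 else 0

theorem abs_triangleRamp_le (p : ℝ × ℝ) : |triangleRamp p| ≤ 1 := by
  unfold triangleRamp
  split_ifs with h
  · linarith [h.2]
  · simp

theorem measurable_triangleRamp : Measurable triangleRamp :=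
  Measurable.ite ((measurableSet_lt measurable_snd.abs measurable_fst.abs).inter
    (measurableSet_lt measurable_fst.abs measurable_const)) measurable_fst measurable_const

theorem abs_integral_deriv_le {η η' : ℝ → ℝ} (hd : ∀ s, HasDerivAt η (η' s) s)
    (hc : Continuous η') (hb : ∀ s, |η s| ≤ 1) (c : ℝ) : |∫ s in -c..c, η' s| ≤ 2 := by
  rw [intervalIntegral.integral_eq_sub_of_hasDerivAt (fun s _ => hd s) (hc.intervalIntegrable _ _)]
  linarith [abs_sub (η c) (η (-c)), hb c, hb (-c)]

/-- Integration by parts: each boundary term contributes at most `c`, and the integral of `η` at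
most `2c`. -/
theorem abs_integral_mul_deriv_le {η η' : ℝ → ℝ} (hd : ∀ s, HasDerivAt η (η' s) s)
    (hc : Continuous η') (hb : ∀ s, |η s| ≤ 1) {c : ℝ} (h0 : 0 ≤ c) :
    |∫ s in -c..c, s * η' s| ≤ 4 * c := by
  rw [intervalIntegral.integral_mul_deriv_eq_deriv_mul (fun s _ => hasDerivAt_id' s)
    (fun s _ => hd s) intervalIntegrable_const (hc.intervalIntegrable _ _)]
  have h1 : |∫ s in -c..c, 1 * η s| ≤ 1 * |c - -c| :=
    intervalIntegral.norm_integral_le_of_norm_le_const (f := fun s => 1 * η s) fun s _ => by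
      rw [one_mul]; exact hb s
  rw [abs_of_nonneg (by linarith : 0 ≤ c - -c)] at h1
  have h2 : |c * η c| ≤ c := by
    rw [abs_mul, abs_of_nonneg h0]; exact mul_le_of_le_one_right h0 (hb c)
  have h3 : |(-c) * η (-c)| ≤ c := by
    rw [abs_mul, abs_neg, abs_of_nonneg h0]; exact mul_le_of_le_one_right h0 (hb _)
  have h4 := abs_sub (c * η c - (-c) * η (-c)) (∫ s in -c..c, 1 * η s)
  have h5 := abs_sub (c * η c) ((-c) * η (-c))
  linarith

theorem integral_Ioo_neg_eq_intervalIntegral {c : ℝ} (h0 : 0 ≤ c) (f : ℝ → ℝ) :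
    ∫ s in Ioo (-c) c, f s = ∫ s in -c..c, f s := by
  rw [intervalIntegral.integral_of_le (by linarith), integral_Ioc_eq_integral_Ioo]

theorem integral_Icc_neg_eq_intervalIntegral {c : ℝ} (h0 : 0 ≤ c) (f : ℝ → ℝ) :
    ∫ s in Icc (-c) c, f s = ∫ s in -c..c, f s := by
  rw [intervalIntegral.integral_of_le (by linarith), integral_Icc_eq_integral_Ioc]

/-- In its second variable the ramp is the constant `a` on `(-|a|, |a|)`, so only two values of `η`
enter. -/
theorem abs_integral_triangleRamp_snd_le {η η' : ℝ → ℝ} (hd : ∀ s, HasDerivAt η (η' s) s)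
    (hc : Continuous η') (hb : ∀ s, |η s| ≤ 1) (a : ℝ) :
    |∫ s, triangleRamp (a, s) * η' s| ≤ (Ioo (-(1 / 2)) (1 / 2 : ℝ)).indicator (fun _ => 4) a := by
  by_cases ha : |a| < 1 / 2
  · rw [indicator_of_mem (show a ∈ Ioo (-(1 / 2)) (1 / 2 : ℝ) from abs_lt.1 ha)]
    have e : (fun s => triangleRamp (a, s) * η' s) =
        (Ioo (-|a|) |a|).indicator fun s => a * η' s := by
      ext s
      by_cases hs : |s| < |a|
      · have hm : s ∈ Ioo (-|a|) |a| := abs_lt.1 hs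
        rw [indicator_of_mem hm, triangleRamp, if_pos ⟨hs, ha⟩]
      · have hm : s ∉ Ioo (-|a|) |a| := fun h => hs (abs_lt.2 h)
        rw [indicator_of_notMem hm, triangleRamp, if_neg fun h => hs h.1, zero_mul]
    rw [e, integral_indicator measurableSet_Ioo, integral_const_mul,
      integral_Ioo_neg_eq_intervalIntegral (abs_nonneg a), abs_mul]
    have := abs_integral_deriv_le hd hc hb |a|
    nlinarith [abs_nonneg a, abs_nonneg (∫ s in -|a|..|a|, η' s)]
  · have e : ∀ s, triangleRamp (a, s) = 0 := fun s => if_neg fun h => ha h.2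
    simp only [e, zero_mul, integral_zero, abs_zero]
    exact indicator_nonneg (fun _ _ => by norm_num) _

/-- In its first variable the ramp is `s` on `|b| < |s| < 1/2`, a difference of two symmetric
intervals. These give `4 · (1/2) + 4 |b| ≤ 4`. -/
theorem abs_integral_triangleRamp_fst_le {η η' : ℝ → ℝ} (hd : ∀ s, HasDerivAt η (η' s) s)
    (hc : Continuous η') (hb : ∀ s, |η s| ≤ 1) (b : ℝ) :
    |∫ s, triangleRamp (s, b) * η' s| ≤ (Ioo (-(1 / 2)) (1 / 2 : ℝ)).indicator (fun _ => 4) b := by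
  by_cases hb' : |b| < 1 / 2
  · rw [indicator_of_mem (show b ∈ Ioo (-(1 / 2)) (1 / 2 : ℝ) from abs_lt.1 hb')]
    have e : (fun s => triangleRamp (s, b) * η' s) =
        (Ioo (-(1 / 2)) (1 / 2) \ Icc (-|b|) |b|).indicator fun s => s * η' s := by
      ext s
      by_cases hs : |b| < |s| ∧ |s| < 1 / 2
      · have hm : s ∈ Ioo (-(1 / 2)) (1 / 2) \ Icc (-|b|) |b| :=
          ⟨abs_lt.1 hs.2, fun h => hs.1.not_ge (abs_le.2 h)⟩
        rw [indicator_of_mem hm, triangleRamp, if_pos hs]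
      · have hm : s ∉ Ioo (-(1 / 2)) (1 / 2) \ Icc (-|b|) |b| :=
          fun h => hs ⟨not_le.1 fun h' => h.2 (abs_le.1 h'), abs_lt.2 h.1⟩
        rw [indicator_of_notMem hm, triangleRamp, if_neg hs, zero_mul]
    have hcc : Continuous fun s => s * η' s := continuous_id.mul hc
    rw [e, integral_indicator (measurableSet_Ioo.diff measurableSet_Icc),
      setIntegral_sdiff measurableSet_Icc
        ((hcc.integrableOn_Icc (a := -(1 / 2)) (b := 1 / 2)).mono_set Ioo_subset_Icc_self)
        (fun s hs => abs_lt.1 ((abs_le.2 hs).trans_lt hb')),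
      integral_Ioo_neg_eq_intervalIntegral (by norm_num),
      integral_Icc_neg_eq_intervalIntegral (abs_nonneg b)]
    have h1 := abs_integral_mul_deriv_le hd hc hb (c := 1 / 2) (by norm_num)
    have h2 := abs_integral_mul_deriv_le hd hc hb (abs_nonneg b)
    have h3 := abs_sub (∫ s in -(1 / 2)..(1 / 2), s * η' s) (∫ s in -|b|..|b|, s * η' s)
    linarith
  · have e : ∀ s, triangleRamp (s, b) = 0 := fun s => if_neg fun h => hb' (h.1.trans h.2)
    simp only [e, zero_mul, integral_zero, abs_zero]
    exact indicator_nonneg (fun _ _ => by norm_num) _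

theorem abs_integral_le_of_le_indicator {f : ℝ → ℝ}
    (h : ∀ s, |f s| ≤ (Ioo (-(1 / 2)) (1 / 2 : ℝ)).indicator (fun _ => 4) s) : |∫ s, f s| ≤ 4 := by
  have hi : Integrable ((Ioo (-(1 / 2)) (1 / 2 : ℝ)).indicator fun _ => (4 : ℝ)) :=
    (integrable_indicator_iff measurableSet_Ioo).2 (integrableOn_const measure_Ioo_lt_top.ne)
  refine (norm_integral_le_of_norm_le (f := f) hi
    (Filter.Eventually.of_forall fun s => h s)).trans_eq ?_
  rw [integral_indicator measurableSet_Ioo]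
  simp
  norm_num

theorem abs_integral_triangleRamp_mul_fderiv_le {χ : ℝ × ℝ → ℝ} (hχ : ContDiff ℝ ∞ χ)
    (hs : HasCompactSupport χ) (hb : ∀ p, |χ p| ≤ 1) :
    |∫ p, triangleRamp p * fderiv ℝ χ p (1, 0)| ≤ 4 ∧
    |∫ p, triangleRamp p * fderiv ℝ χ p (0, 1)| ≤ 4 := by
  have hfc : Continuous (fderiv ℝ χ) := hχ.continuous_fderiv (by simp)
  have hc : ∀ v, Continuous fun p => fderiv ℝ χ p v := fun v => hfc.clm_apply continuous_const
  have hi : ∀ v, Integrable (fun p => triangleRamp p * fderiv ℝ χ p v)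
      ((volume : Measure ℝ).prod volume) := fun v =>
    Integrable.bdd_mul ((hc v).integrable_of_hasCompactSupport (hs.fderiv_apply ℝ v))
      measurable_triangleRamp.aestronglyMeasurable (c := 1)
      (Filter.Eventually.of_forall abs_triangleRamp_le)
  have hd : ∀ p, HasFDerivAt χ (fderiv ℝ χ p) p := fun p =>
    (hχ.differentiable (by simp) p).hasFDerivAt
  constructor
  · rw [Measure.volume_eq_prod, integral_prod_symm _ (hi _)]
    refine abs_integral_le_of_le_indicator fun b => ?_
    exact abs_integral_triangleRamp_fst_le (η := fun s => χ (s, b))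
      (fun s => (hd (s, b)).comp_hasDerivAt s ((hasDerivAt_id s).prodMk (hasDerivAt_const s b)))
      ((hc _).comp (Continuous.prodMk_left b)) (fun _ => hb _) b
  · rw [Measure.volume_eq_prod, integral_prod _ (hi _)]
    refine abs_integral_le_of_le_indicator fun a => ?_
    exact abs_integral_triangleRamp_snd_le (η := fun s => χ (a, s))
      (fun s => (hd (a, s)).comp_hasDerivAt s ((hasDerivAt_const s a).prodMk (hasDerivAt_id s)))
      ((hc _).comp (Continuous.prodMk_right a)) (fun _ => hb _) a

/-- The plane as a product. -/
noncomputable def prodEquivPlane : (ℝ × ℝ) ≃L[ℝ] Plane :=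
  LinearEquiv.toContinuousLinearEquiv
    { toFun := fun p => !₂[p.1, p.2]
      invFun := fun x => (x 0, x 1)
      map_add' := fun p q => by ext i; fin_cases i <;> simp
      map_smul' := fun c p => by ext i; fin_cases i <;> simp
      left_inv := fun p => by simp
      right_inv := fun x => by ext i; fin_cases i <;> simp }

theorem prodEquivPlane_apply (p : ℝ × ℝ) : prodEquivPlane p = !₂[p.1, p.2] := rfl

theorem prodEquivPlane_symm_apply (x : Plane) : prodEquivPlane.symm x = (x 0, x 1) := rfl

theorem measurePreserving_prodEquivPlane : MeasurePreserving prodEquivPlane volume volume :=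
  (PiLp.volume_preserving_toLp (Fin 2)).comp (volume_preserving_finTwoArrow ℝ).symm

/-- The identification `E` is left free because the components of `depauwW` are the same ramp in the
two orders of the coordinates. -/
theorem abs_integral_triangleRamp_comp_le (E : (ℝ × ℝ) ≃L[ℝ] Plane)
    (hE : MeasurePreserving E volume volume) {ψ : Plane → ℝ} (hψ : ContDiff ℝ ∞ ψ)
    (hs : HasCompactSupport ψ) (hb : ∀ x, |ψ x| ≤ 1) :
    |∫ x, triangleRamp (E.symm x) * fderiv ℝ ψ x (E (1, 0))| ≤ 4 ∧
    |∫ x, triangleRamp (E.symm x) * fderiv ℝ ψ x (E (0, 1))| ≤ 4 := by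
  have h := abs_integral_triangleRamp_mul_fderiv_le (hψ.comp E.contDiff)
    (hs.comp_homeomorph E.toHomeomorph) (fun p => hb (E p))
  have e : ∀ v, ∫ x, triangleRamp (E.symm x) * fderiv ℝ ψ x (E v) =
      ∫ p, triangleRamp p * fderiv ℝ (ψ ∘ E) p v := by
    intro v
    rw [← hE.integral_comp E.toHomeomorph.measurableEmbedding]
    refine integral_congr_ae (Filter.Eventually.of_forall fun p => ?_)
    simp only [ContinuousLinearEquiv.symm_apply_apply]
    rw [fderiv_comp p (hψ.differentiable (by simp) _) E.differentiableAt, E.fderiv]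
    rfl
  rw [e, e]
  exact h

theorem depauwW_apply_zero (x : Plane) : depauwW x 0 = -4 * triangleRamp (x 1, x 0) := by
  unfold depauwW triangleRamp
  split_ifs with h1 h2 h3
  · exact absurd (h1.1.trans h2.1) (lt_irrefl _)
  all_goals simp

theorem depauwW_apply_one (x : Plane) : depauwW x 1 = 4 * triangleRamp (x 0, x 1) := by
  unfold depauwW triangleRamp
  split_ifs <;> simp

theorem abs_integral_depauwW_mul_fderiv_le {ψ : Plane → ℝ} (hψ : ContDiff ℝ ∞ ψ)
    (hs : HasCompactSupport ψ) (hb : ∀ x, |ψ x| ≤ 1) (i j : Fin 2) :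
    |∫ x, depauwW x i * fderiv ℝ ψ x (EuclideanSpace.single j 1)| ≤ 16 := by
  have e0 : prodEquivPlane (1, 0) = EuclideanSpace.single 0 1 := by
    ext k; fin_cases k <;> simp [prodEquivPlane_apply]
  have e1 : prodEquivPlane (0, 1) = EuclideanSpace.single 1 1 := by
    ext k; fin_cases k <;> simp [prodEquivPlane_apply]
  have h1 := abs_integral_triangleRamp_comp_le prodEquivPlane measurePreserving_prodEquivPlane
    hψ hs hb
  have h2 := abs_integral_triangleRamp_comp_le
    ((ContinuousLinearEquiv.prodComm ℝ ℝ ℝ).trans prodEquivPlane)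
    (measurePreserving_prodEquivPlane.comp Measure.measurePreserving_swap) hψ hs hb
  have k0 : ((ContinuousLinearEquiv.prodComm ℝ ℝ ℝ).trans prodEquivPlane) (1, 0) =
    EuclideanSpace.single 1 1 := e1
  have k1 : ((ContinuousLinearEquiv.prodComm ℝ ℝ ℝ).trans prodEquivPlane) (0, 1) =
    EuclideanSpace.single 0 1 := e0
  have k2 : ∀ x, ((ContinuousLinearEquiv.prodComm ℝ ℝ ℝ).trans prodEquivPlane).symm x =
    (x 1, x 0) := fun x => rfl
  rw [e0, e1] at h1
  rw [k0, k1] at h2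
  simp only [prodEquivPlane_symm_apply] at h1
  simp only [k2] at h2
  fin_cases i
  · simp only [Fin.zero_eta, depauwW_apply_zero, mul_assoc]
    rw [integral_const_mul, abs_mul, abs_neg, abs_of_pos (by norm_num : (0 : ℝ) < 4)]
    fin_cases j
    · simp only [Fin.zero_eta]; linarith [h2.2]
    · simp only [Fin.mk_one]; linarith [h2.1]
  · simp only [Fin.mk_one, depauwW_apply_one, mul_assoc]
    rw [integral_const_mul, abs_mul, abs_of_pos (by norm_num : (0 : ℝ) < 4)]
    fin_cases j
    · simp only [Fin.zero_eta]; linarith [h1.1]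
    · simp only [Fin.mk_one]; linarith [h1.2]

/-- Under the substitution the area contributes `2⁻²ᵏ` and the derivative `2ᵏ`; the resulting factor
`2⁻ᵏ ≤ 1` is discarded. -/
theorem abs_integral_depauwW_scaled_mul_fderiv_le (k : ℕ) (y : Plane) {ψ : Plane → ℝ}
    (hψ : ContDiff ℝ ∞ ψ) (hs : HasCompactSupport ψ) (hb : ∀ x, |ψ x| ≤ 1) (i j : Fin 2) :
    |∫ x, depauwW ((2 : ℝ) ^ k • x - y) i * fderiv ℝ ψ x (EuclideanSpace.single j 1)| ≤ 16 := by
  set e : Plane := EuclideanSpace.single j 1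
  have hr : (1 / 2 : ℝ) ^ k ≠ 0 := by positivity
  set S : Plane ≃ₜ Plane := (Homeomorph.addRight y).trans (Homeomorph.smulOfNeZero _ hr) with hS
  have hSa : ∀ z, S z = (1 / 2 : ℝ) ^ k • (z + y) := fun z => rfl
  have hSd : ∀ z, HasFDerivAt S ((1 / 2 : ℝ) ^ k • ContinuousLinearMap.id ℝ Plane) z := fun z =>
    ((hasFDerivAt_id z).add_const y).const_smul ((1 / 2 : ℝ) ^ k)
  have hSc : ContDiff ℝ ∞ S := by
    have : ContDiff ℝ ∞ fun z : Plane => (1 / 2 : ℝ) ^ k • (z + y) := by fun_prop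
    exact this
  have h := abs_integral_depauwW_mul_fderiv_le (hψ.comp hSc) (hs.comp_homeomorph S)
    (fun z => hb (S z)) i j
  have h1 : ∀ z, fderiv ℝ (ψ ∘ S) z e = (1 / 2 : ℝ) ^ k * fderiv ℝ ψ (S z) e := by
    intro z
    rw [((hψ.differentiable (by simp) (S z)).hasFDerivAt.comp z (hSd z)).fderiv]
    simp
  have h2 : ∫ x, depauwW ((2 : ℝ) ^ k • x - y) i * fderiv ℝ ψ x e =
      (1 / 2 : ℝ) ^ k * ∫ z, depauwW z i * fderiv ℝ (ψ ∘ S) z e := by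
    have h3 := Measure.integral_comp_smul (volume : Measure Plane)
      (fun z => depauwW (z - y) i * fderiv ℝ ψ ((1 / 2 : ℝ) ^ k • z) e) ((2 : ℝ) ^ k)
    have h4 : ∀ x : Plane, (1 / 2 : ℝ) ^ k • (2 : ℝ) ^ k • x = x := fun x => by
      rw [smul_smul, ← mul_pow]; norm_num
    simp only [h4] at h3
    rw [h3, ← integral_add_right_eq_self _ y]
    simp only [add_sub_cancel_right, h1, ← hSa, mul_left_comm _ ((1 / 2 : ℝ) ^ k)]
    rw [integral_const_mul, smul_eq_mul, ← mul_assoc]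
    congr 1
    rw [finrank_euclideanSpace_fin, abs_of_pos (by positivity), ← inv_pow, ← inv_pow]
    norm_num
    ring
  rw [h2, abs_mul, abs_of_nonneg (by positivity)]
  have h5 : (1 / 2 : ℝ) ^ k ≤ 1 := pow_le_one₀ (by norm_num) (by norm_num)
  nlinarith [abs_nonneg (∫ z, depauwW z i * fderiv ℝ (ψ ∘ S) z e)]

/-- On a ball only finitely many cells contribute to the rescaled field. -/
theorem exists_finset_depauwU_eq_sum (k : ℕ) (R : ℝ) :
    ∃ N : Finset (ℤ × ℤ), ∀ x : Plane, ‖x‖ < R →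
      depauwU ((2 : ℝ) ^ k • x) = ∑ n ∈ N, depauwW ((2 : ℝ) ^ k • x - latticePoint n) := by
  classical
  set m : ℤ := ⌈(2 : ℝ) ^ k * R⌉ + 1 with hm
  refine ⟨(Finset.Icc (-m) m ×ˢ Finset.Icc (-m) m).filter fun n => Even (n.1 + n.2),
    fun x hx => ?_⟩
  set y := (2 : ℝ) ^ k • x with hy
  rw [depauwU_eq_ite]
  split_ifs with hA
  · rw [Finset.sum_eq_single (nearestCell y)]
    · intro n hn hne
      by_contra h
      exact hne (isActive_and_nearestCell_eq (Finset.mem_filter.1 hn).2 h).2.symm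
    · intro hn
      refine absurd (Finset.mem_filter.2 ⟨Finset.mem_product.2 ⟨?_, ?_⟩, hA.1⟩) hn <;>
      · have hyi : ∀ i, |y i| ≤ (2 : ℝ) ^ k * R := by
          intro i
          have h1 : ‖y i‖ ≤ ‖y‖ := PiLp.norm_apply_le y i
          rw [hy, norm_smul, Real.norm_of_nonneg (by positivity : (0 : ℝ) ≤ 2 ^ k)] at h1
          exact h1.trans (mul_le_mul_of_nonneg_left hx.le (by positivity))
        have hround : ∀ i, round (y i) ∈ Finset.Icc (-m) m := by
          intro i
          have h1 := abs_le.1 (abs_sub_round (y i))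
          have h2 := abs_le.1 (hyi i)
          have h3 := Int.le_ceil ((2 : ℝ) ^ k * R)
          have h4 : ((round (y i) : ℤ) : ℝ) ≤ (m : ℤ) := by rw [hm]; push_cast; linarith
          have h5 : ((-m : ℤ) : ℝ) ≤ (round (y i) : ℤ) := by rw [hm]; push_cast; linarith
          exact Finset.mem_Icc.2 ⟨by exact_mod_cast h5, by exact_mod_cast h4⟩
        exact hround _
  · refine (Finset.sum_eq_zero fun n hn => ?_).symm
    by_contra h
    exact hA (isActive_and_nearestCell_eq (Finset.mem_filter.1 hn).2 h).1

theorem exists_totalVariation_depauwU_le (k : ℕ) (R : ℝ) :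
    ∃ C : ℝ, totalVariation (fun x => depauwU ((2 : ℝ) ^ k • x)) (Metric.ball 0 R) ≤
      ENNReal.ofReal C := by
  obtain ⟨N, hN⟩ := exists_finset_depauwU_eq_sum k R
  refine ⟨∑ _n ∈ N, ∑ _i : Fin 2, ∑ _j : Fin 2, 16, ?_⟩
  refine iSup_le fun Φ => iSup_le fun hΦ => iSup_le fun hb => ENNReal.ofReal_le_ofReal ?_
  have hdiff : ∀ i x, DifferentiableAt ℝ (Φ i) x := fun i x =>
    (hΦ i).1.differentiable (by simp) x
  have hψ : ∀ i j : Fin 2, ContDiff ℝ ∞ fun x => Φ i x j := fun i j =>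
    (EuclideanSpace.proj (𝕜 := ℝ) j).contDiff.comp (hΦ i).1
  have hψd : ∀ (i j : Fin 2) (x e : Plane),
      fderiv ℝ (fun x => Φ i x j) x e = fderiv ℝ (Φ i) x e j := by
    intro i j x e
    have h := (EuclideanSpace.proj (𝕜 := ℝ) j).hasFDerivAt.comp x (hdiff i x).hasFDerivAt
    have h' : HasFDerivAt (fun x => Φ i x j) _ x := h
    rw [h'.fderiv]
    rfl
  have hψs : ∀ i j : Fin 2, HasCompactSupport fun x => Φ i x j := fun i j =>
    (hΦ i).2.1.comp_left (g := fun y : Plane => y j) rfl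
  have hψb : ∀ (i j : Fin 2) x, |Φ i x j| ≤ 1 := by
    intro i j x
    have h1 : ‖Φ i x j‖ ≤ ‖Φ i x‖ := PiLp.norm_apply_le (Φ i x) j
    have h2 : ‖Φ i x‖ ^ 2 ≤ 1 := (Finset.single_le_sum (f := fun i => ‖Φ i x‖ ^ 2)
      (fun _ _ => by positivity) (Finset.mem_univ i)).trans (hb x)
    have h3 : ‖Φ i x‖ ≤ 1 := (sq_le_one_iff₀ (norm_nonneg _)).1 h2
    exact h1.trans h3
  have hpt : ∀ x, ∑ i, depauwU ((2 : ℝ) ^ k • x) i * divergence (Φ i) x =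
      ∑ n ∈ N, ∑ i, ∑ j, depauwW ((2 : ℝ) ^ k • x - latticePoint n) i *
        fderiv ℝ (fun x => Φ i x j) x (EuclideanSpace.single j 1) := by
    intro x
    rw [Finset.sum_comm]
    refine Finset.sum_congr rfl fun i _ => ?_
    simp only [hψd, divergence]
    by_cases hx : x ∈ Metric.ball (0 : Plane) R
    · rw [hN x (mem_ball_zero_iff.1 hx)]
      simp only [WithLp.ofLp_sum, Finset.sum_apply, Finset.sum_mul, Finset.mul_sum]
      rw [Finset.sum_comm]
    -- The finite sum represents the field on the ball only; elsewhere the test fields vanish.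
    · have h0 : fderiv ℝ (Φ i) x = 0 := by
        by_contra h
        exact hx ((hΦ i).2.2 (support_fderiv_subset ℝ h))
      simp [h0]
  have hi : ∀ (n : ℤ × ℤ) (i j : Fin 2), Integrable fun x =>
      depauwW ((2 : ℝ) ^ k • x - latticePoint n) i *
        fderiv ℝ (fun x => Φ i x j) x (EuclideanSpace.single j 1) := by
    intro n i j
    have hm : Measurable fun x : Plane => depauwW ((2 : ℝ) ^ k • x - latticePoint n) i := by
      have h1 : Measurable fun x : Plane => (2 : ℝ) ^ k • x - latticePoint n :=
        (measurable_const_smul ((2 : ℝ) ^ k)).sub_const _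
      have h2 : Measurable fun x : Plane => x i := by fun_prop
      exact h2.comp (measurable_depauwW.comp h1)
    refine Integrable.bdd_mul (Continuous.integrable_of_hasCompactSupport
      (((hψ i j).continuous_fderiv (by simp)).clm_apply continuous_const)
      ((hψs i j).fderiv_apply ℝ _)) hm.aestronglyMeasurable (c := 4)
      (Filter.Eventually.of_forall fun x => ?_)
    exact (PiLp.norm_apply_le _ i).trans (norm_depauwW_le _)
  simp only [hpt]
  rw [integral_finsetSum _ fun n _ => integrable_finsetSum _ fun i _ =>
    integrable_finsetSum _ fun j _ => hi n i j]
  refine Finset.sum_le_sum fun n _ => ?_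
  rw [integral_finsetSum _ fun i _ => integrable_finsetSum _ fun j _ => hi n i j]
  refine Finset.sum_le_sum fun i _ => ?_
  rw [integral_finsetSum _ fun j _ => hi n i j]
  exact Finset.sum_le_sum fun j _ => (le_abs_self _).trans
    (abs_integral_depauwW_scaled_mul_fderiv_le k (latticePoint n) (hψ i j) (hψs i j) (hψb i j) i j)

theorem isL1locBVloc_depauwField : IsL1locBVloc depauwField := by
  refine ⟨measurable_depauwField.aestronglyMeasurable, fun s T R hs => ?_⟩
  -- Only levels below `K` meet times `t ≥ s`, so the sum of their variations bounds the variation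
  -- at each such time.
  obtain ⟨K, hK⟩ := exists_pow_lt_of_lt_one hs (show (1 / 2 : ℝ) < 1 by norm_num)
  choose C hC using fun k => exists_totalVariation_depauwU_le k R
  set B : ℝ≥0∞ := ENNReal.ofReal 4 * volume (Metric.ball (0 : Plane) R) +
    ∑ k ∈ Finset.range K, ENNReal.ofReal (C k) with hB
  have hBtop : B < ⊤ := ENNReal.add_lt_top.2
    ⟨ENNReal.mul_lt_top ENNReal.ofReal_lt_top measure_ball_lt_top,
      ENNReal.sum_lt_top.2 fun _ _ => ENNReal.ofReal_lt_top⟩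
  refine (setLIntegral_mono' (g := fun _ => B) measurableSet_Icc fun t ht =>
    add_le_add ?_ ?_).trans_lt ?_
  · rw [← setLIntegral_const]
    refine lintegral_mono fun x => ?_
    rw [← ofReal_norm]
    exact ENNReal.ofReal_le_ofReal (norm_depauwField_le _)
  · by_cases h : t ∈ Ioo ((1 / 2 : ℝ) ^ (dyadicLevel t + 1)) ((1 / 2 : ℝ) ^ dyadicLevel t)
    · simp only [depauwField_of_mem_Ioo h]
      refine (hC _).trans (Finset.single_le_sum (f := fun k => ENNReal.ofReal (C k))
        (fun _ _ => zero_le) (Finset.mem_range.2 ?_))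
      by_contra h'
      have h1 : (1 / 2 : ℝ) ^ dyadicLevel t ≤ (1 / 2 : ℝ) ^ K :=
        pow_le_pow_of_le_one (by norm_num) (by norm_num) (not_lt.1 h')
      linarith [h.2, ht.1]
    · have h0 : ∀ x, depauwField (t, x) = 0 := fun x => by
        rw [depauwField_eq_indicator]
        exact indicator_of_notMem h _
      simp [h0, totalVariation]
  · rw [setLIntegral_const]
    exact ENNReal.mul_lt_top hBtop measure_Icc_lt_top

theorem mainTheorem2 :
    IsBoundedField depauwField ∧ IsDivergenceFree depauwField ∧ IsL1locBVloc depauwField ∧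
    ∀ ρ₀ : EuclideanSpace ℝ (Fin 2) → ℝ, MemLp ρ₀ ⊤ volume →
      (∃ ρ₁ ρ₂ : ℝ × EuclideanSpace ℝ (Fin 2) → ℝ,
        IsBoundedWeakSolution depauwField ρ₀ ρ₁ ∧
        IsBoundedWeakSolution depauwField ρ₀ ρ₂ ∧
        ¬ ρ₁ =ᵐ[spaceTimeMeasure 2] ρ₂) ∧
      (0 ≤ᵐ[volume] ρ₀ → ¬ ρ₀ =ᵐ[volume] 0 →
        ∃ ρ₁ ρ₂ : ℝ × EuclideanSpace ℝ (Fin 2) → ℝ,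
          IsBoundedWeakSolution depauwField ρ₀ ρ₁ ∧ 0 ≤ᵐ[spaceTimeMeasure 2] ρ₁ ∧
          IsBoundedWeakSolution depauwField ρ₀ ρ₂ ∧ 0 ≤ᵐ[spaceTimeMeasure 2] ρ₂ ∧
          ¬ ρ₁ =ᵐ[spaceTimeMeasure 2] ρ₂) :=
  ⟨isBoundedField_depauwField, isDivergenceFree_depauwField, isL1locBVloc_depauwField,
    fun _ h => exists_two_solutions h⟩
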